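/- Let $k\ge 1$ and let $P=(p_{ij})$ be an irreducible column-stochastic real $k\times k$ matrix ($p_{ij}\ge 0$, $\sum_i p_{ij}=1$ for every $j$, and $P$ irreducible in the sense of Markov chains, $p_{ij}$ being the probability of moving from $j$ to $i$). Put $V_{ij}=\sqrt{p_{ij}}\,|i\rangle\langle j|$, let $\mu=\sum_{i,j}\delta_{V_{ij}}$ be the associated measure on the space $M_k$ of complex $k\times k$ matrices, and let $L$ be the identity map of $M_k$. For $\omega=(\omega_1,\omega_2,\dots)\in M_k^{\mathbb N}$ write $W_n(\omega)=\omega_n\cdots\omega_1$. Then for every Borel probability $\nu$ on the projective space $P(\mathbb C^k)$ there is a unique probability $\mathbb P_\nu$ on $P(\mathbb C^k)\times M_k^{\mathbb N}$ such that, for all $n$, all Borel $S\subseteq P(\mathbb C^k)$ and all Borel $A\subseteq M_k^n$, $$\mathbb P_\nu\big(S\times\{\omega:(\omega_1,\dots,\omega_n)\in A\}\big)=\int_{S\times A}\|v_n\cdots v_1x\|^2\,d\nu(\hat x)\,d\mu^{\otimes n}(v_1,\dots,v_n),$$ where $x$ is a unit representative of $\hat x$. The Lyapunov exponents of $(L,\mu)$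 are well defined: there are unique $\infty>\gamma_1\ge\gamma_2\ge\dots\ge\gamma_k\ge-\infty$ such that, for every probability $\nu$ on $P(\mathbb C^k)$ and every $p\in\{1,\dots,k\}$, $\mathbb P_\nu$-almost surely $$\lim_{n\to\infty}\frac1n\log\Big\|\bigwedge\nolimits^{p}W_n\Big\|=\gamma_1+\dots+\gamma_p ,$$ where $\|\cdot\|$ is the operator norm on $\bigwedge^p\mathbb C^k$ and $\log 0=-\infty$. Let $\pi$ be the unique probability vector with $P\pi=\pi$, let $m$ be the law on $\{1,\dots,k\}^{\mathbb N}$ of the Markov chain with initial law $\pi$ and transition probabilities $p_{ij}$ (from $j$ to $i$), which is invariant under the shift, and let $h$ be the Kolmogorov–Shannon (Kolmogorov–Sinai) entropy of the shift with respect to $m$, i.e. the supremum over finite measurable partitions $\xi$ of $\lim_n\frac1nH_m(\xi\vee T^{-1}\xi\vee\dots\vee T^{-(n-1)}\xi)$, with $T$ the shift. Then $$\gamma_1=\frac12\sum_{i,j}\pi_j\,p_{ij}\log p_{ij}=-\frac h2\qquad(0\log 0=0),$$ and, if $k\ge 2$, $\gamma_2=-\infty$. -/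

import Mathlib

open MeasureTheory Filter Topology
open scoped ENNReal LinearAlgebra.Projectivization

noncomputable section

/-! ### Matrices and complex projective space -/

/-- The space `M_k` of complex `k × k` matrices. -/
abbrev CMat (k : ℕ) : Type := Matrix (Fin k) (Fin k) ℂ

/-- The Borel σ-algebra of `M_k`, i.e. the product σ-algebra of its entries. -/
instance CMat.instMeasurableSpace (k : ℕ) : MeasurableSpace (CMat k) :=
  inferInstanceAs (MeasurableSpace (Fin k → Fin k → ℂ))

/-- The projective space `P(ℂ^k)`. -/
abbrev CProj (k : ℕ) : Type := ℙ ℂ (EuclideanSpace ℂ (Fin k))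

/-- The usual (quotient) topology of `P(ℂ^k)`; it is the one induced by the metric
`d(x̂, ŷ) = (1 - |⟨x, y⟩|²)^{1/2}`, with `x`, `y` unit representatives. -/
instance CProj.instTopologicalSpace (k : ℕ) : TopologicalSpace (CProj k) :=
  TopologicalSpace.coinduced
    (fun v : {v : EuclideanSpace ℂ (Fin k) // v ≠ 0} => Projectivization.mk' ℂ v) inferInstance

/-- The Borel σ-algebra of `P(ℂ^k)`. -/
instance CProj.instMeasurableSpace (k : ℕ) : MeasurableSpace (CProj k) := borel _

/-- `‖A x‖²`, where `x` is a unit representative of the line `x̂` (the value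
`(‖A y‖ / ‖y‖)²` is the same for every representative `y` of `x̂`). -/
def normSqOn {k : ℕ} (A : CMat k) (x : CProj k) : ℝ≥0∞ :=
  ENNReal.ofReal ((‖Matrix.toEuclideanCLM (𝕜 := ℂ) A x.rep‖ / ‖x.rep‖) ^ 2)

/-! ### The matrix product process -/

/-- `W_n = L(v_n) ⋯ L(v_1)`; the tuple `(v_1, …, v_n)` is indexed by `0, …, n - 1`. -/
def matProd {k : ℕ} (L : CMat k → CMat k) : (n : ℕ) → (Fin n → CMat k) → CMat k
  | 0, _ => 1
  | n + 1, v => L (v (Fin.last n)) * matProd L n (fun i => v i.castSucc)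

/-- `Q` is the probability `ℙ_ν` on `P(ℂ^k) × M_k^ℕ`: for all `n`, Borel `S ⊆ P(ℂ^k)` and
Borel `A ⊆ M_k^n`, the mass of `S × {ω | (ω_1, …, ω_n) ∈ A}` is
`∫_{S × A} ‖W_n(v) x‖² dν(x̂) dμ^{⊗ n}(v)`. -/
def IsTrajectoryLaw {k : ℕ} (μ : Measure (CMat k)) (L : CMat k → CMat k)
    (ν : Measure (CProj k)) (Q : Measure (CProj k × (ℕ → CMat k))) : Prop :=
  IsProbabilityMeasure Q ∧
    ∀ (n : ℕ) (S : Set (CProj k)) (A : Set (Fin n → CMat k)),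
      MeasurableSet S → MeasurableSet A →
        Q (S ×ˢ {ω | (fun i : Fin n => ω i) ∈ A}) =
          ∫⁻ x in S, ∫⁻ v in A, normSqOn (matProd L n v) x ∂(Measure.pi fun _ => μ) ∂ν

/-! ### Lyapunov exponents -/

/-- The operator norm of `⋀^p A` on `⋀^p ℂ^k`, for the inner product
`⟨r_1 ∧ ⋯ ∧ r_p, s_1 ∧ ⋯ ∧ s_p⟩ = det (⟨r_i, s_j⟩)`. The vectors `e_{i_1} ∧ ⋯ ∧ e_{i_p}` with
`i_1 < ⋯ < i_p` are an orthonormal basis for it, so this is the `ℓ²` operator norm of the matrix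
of `⋀^p A` in that basis. -/
def wedgeNorm {k : ℕ} (p : ℕ) (A : CMat k) : ℝ :=
  ‖Matrix.toEuclideanCLM (𝕜 := ℂ)
    (LinearMap.toMatrix ((Pi.basisFun ℂ (Fin k)).exteriorPower p)
      ((Pi.basisFun ℂ (Fin k)).exteriorPower p) (exteriorPower.map p (Matrix.toLin' A)))‖

/-- `γ_1 ≥ ⋯ ≥ γ_k` (indexed by `0, …, k - 1`) are the Lyapunov exponents of `(μ, L)`:
`∞ > γ_1 ≥ ⋯ ≥ γ_k ≥ -∞` and, for every probability `ν` on `P(ℂ^k)` and every `1 ≤ p ≤ k`,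
`(1/n) log |⋀^p W_n| → γ_1 + ⋯ + γ_p` holds `ℙ_ν`-almost surely, with `log 0 = -∞`. -/
def IsLyapunovSpectrum {k : ℕ} (μ : Measure (CMat k)) (L : CMat k → CMat k)
    (γ : Fin k → EReal) : Prop :=
  Antitone γ ∧ (∀ j, γ j < ⊤) ∧
    ∀ ν : Measure (CProj k), IsProbabilityMeasure ν →
      ∀ Q : Measure (CProj k × (ℕ → CMat k)), IsTrajectoryLaw μ L ν Q →
        ∀ p : ℕ, 1 ≤ p → p ≤ k →
          ∀ᵐ z ∂Q, Tendsto
            (fun n : ℕ => ((1 / (n : ℝ) : ℝ) : EReal) *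
              ENNReal.log (ENNReal.ofReal
                (wedgeNorm p (matProd L n fun i : Fin n => z.2 i))))
            atTop (𝓝 (∑ j : Fin k with j.val < p, γ j))

/-! ### The Markov chain of a column-stochastic matrix -/

/-- `μ = ∑_{i,j} δ_{V_ij}` with `V_ij = √p_ij |i⟩⟨j|`. -/
def markovChannelMeasure {k : ℕ} (P : Matrix (Fin k) (Fin k) ℝ) : Measure (CMat k) :=
  ∑ i, ∑ j, Measure.dirac (Matrix.single i j ((√(P i j) : ℝ) : ℂ))

/-- `π` is a probability vector with `P π = π`. -/
def IsInvariantProbVector {k : ℕ} (P : Matrix (Fin k) (Fin k) ℝ) (π : Fin k → ℝ) : Prop :=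
  π ∈ stdSimplex ℝ (Fin k) ∧ P.mulVec π = π

/-- `m` is the law on `{1, …, k}^ℕ` of the Markov chain with initial law `π` which moves from
`j` to `i` with probability `P i j`. -/
def IsMarkovLaw {k : ℕ} (P : Matrix (Fin k) (Fin k) ℝ) (π : Fin k → ℝ)
    (m : Measure (ℕ → Fin k)) : Prop :=
  IsProbabilityMeasure m ∧
    ∀ (n : ℕ) (s : Fin (n + 1) → Fin k),
      m {ω | ∀ i : Fin (n + 1), ω i = s i} =
        ENNReal.ofReal (π (s 0) * ∏ i : Fin n, P (s i.succ) (s i.castSucc))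

/-! ### Kolmogorov–Sinai entropy -/

/-- The Shannon entropy `-∑_a m(η = a) log m(η = a)` of a finite-valued map `η`, i.e. of the
partition into its fibres. -/
def partitionEntropy {X ι : Type*} [MeasurableSpace X] [Fintype ι] (m : Measure X)
    (η : X → ι) : ℝ :=
  ∑ a, Real.negMulLog (m.real (η ⁻¹' {a}))

/-- The Kolmogorov–Sinai entropy of `T` with respect to `m`: the supremum over all finite
measurable partitions `ξ` of `lim_n (1/n) H(ξ ∨ T⁻¹ξ ∨ ⋯ ∨ T^{-(n-1)}ξ)`. The limit exists when
`T` preserves the probability `m`, so it is written as an upper limit. -/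
def kolmogorovEntropy {X : Type*} [MeasurableSpace X] (T : X → X) (m : Measure X) : EReal :=
  ⨆ (r : ℕ) (ξ : X → Fin r) (_ : Measurable ξ),
    limsup (fun n : ℕ =>
      ((1 / (n : ℝ) * partitionEntropy m (fun x => fun i : Fin n => ξ (T^[i] x)) : ℝ) : EReal))
      atTop

/-- The shift `(ω_0, ω_1, …) ↦ (ω_1, ω_2, …)`. -/
def seqShift {α : Type*} (ω : ℕ → α) : ℕ → α := fun n => ω (n + 1)

end

/-! Every `V_ij` has rank one: it reads coordinate `j` and writes it, scaled by `√p_ij`, at `i`. A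
product of such matrices vanishes unless the transitions chain up into a path `s_0, …, s_n`, and
then it equals `∏ √p(s_{i+1}, s_i) |s_n⟩⟨s_0|`. Its squared norm at a unit vector `x` is `|x_{s_0}|²
∏ p(s_{i+1}, s_i)`, the probability of that path for the chain started from the weights `|x_j|²`.
Hence `ℙ_ν` is a mixture over `j` of laws of chains started at `j` (`isTrajectoryLaw_mixture`).

Along such a path `log ‖W_n‖` is half the sum of `log p(s_{i+1}, s_i)` up to a bounded term, so
`γ_1` comes from a strong law for transitions valid for every initial law
(`IsMarkovLaw.ae_tendsto_average`). The Poisson equation reduces this law to centred increments,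
which a Chernoff bound and Borel–Cantelli control; aperiodicity plays no role. Exterior powers of
order at least two kill rank-one matrices, which gives `-∞` for all later exponents.

For the entropy (`IsMarkovLaw.kolmogorovEntropy_eq`), the partition by the first symbol attains the
rate by the chain rule. Any other finite partition is close to a cylinder partition, so its symbols
can be guessed from a path prefix; the logarithmic loss of the guess bounds the excess entropy per
symbol by an arbitrarily small amount. -/

/-! ### Invariant vectors and the Poisson equation of an irreducible stochastic matrix -/

section Stochastic

variable {k : ℕ} {P : Matrix (Fin k) (Fin k) ℝ}

/-- A left-invariant vector of an irreducible column-stochastic matrix is constant. -/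
lemma eq_of_vecMul_eq_self (hP : P ∈ Matrix.colStochastic ℝ (Fin k)) (hirr : P.IsIrreducible)
    {f : Fin k → ℝ} (hf : Matrix.vecMul f P = f) (i j : Fin k) : f i = f j := by
  have hpow : ∀ n : ℕ, Matrix.vecMul f (P ^ n) = f := by
    intro n
    induction n with
    | zero => simp
    | succ n ih => rw [pow_succ, ← Matrix.vecMul_vecMul, ih, hf]
  have : Nonempty (Fin k) := ⟨i⟩
  -- Maximum principle: `f a` is the average of `f` under column `a` of `P ^ n`, so any `i` of
  -- positive weight there also attains the maximum.
  obtain ⟨a, ha⟩ := Finite.exists_max f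
  suffices h : ∀ i, f i = f a by rw [h i, h j]
  intro i
  obtain ⟨n, -, hn⟩ := (Matrix.isIrreducible_iff_exists_pow_pos hirr.nonneg).1 hirr i a
  have hPn : P ^ n ∈ Matrix.colStochastic ℝ (Fin k) := pow_mem hP n
  have h1 : ∑ l, (f a - f l) * (P ^ n) l a = 0 := by
    have h2 : ∑ l, f l * (P ^ n) l a = f a := congrFun (hpow n) a
    have h3 := Matrix.sum_col_of_mem_colStochastic hPn a
    simp only [sub_mul, Finset.sum_sub_distrib, h2, ← Finset.mul_sum, h3]
    ring
  have h4 := (Finset.sum_eq_zero_iff_of_nonneg (fun l _ =>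
    mul_nonneg (sub_nonneg.2 (ha l)) (Matrix.nonneg_of_mem_colStochastic hPn))).1 h1 i
    (Finset.mem_univ i)
  rcases mul_eq_zero.1 h4 with h | h
  · linarith
  · exact absurd h hn.ne'

lemma finrank_ker_vecMul [NeZero k] (hP : P ∈ Matrix.colStochastic ℝ (Fin k))
    (hirr : P.IsIrreducible) :
    Module.finrank ℝ (LinearMap.ker (1 - P).transpose.mulVecLin) = 1 := by
  have h : LinearMap.ker (1 - P).transpose.mulVecLin = Submodule.span ℝ {(1 : Fin k → ℝ)} := by
    ext f
    rw [LinearMap.mem_ker, Matrix.mulVecLin_apply, Matrix.mulVec_transpose, Matrix.vecMul_sub,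
      Matrix.vecMul_one, sub_eq_zero, Submodule.mem_span_singleton]
    constructor
    · intro hf
      refine ⟨f 0, ?_⟩
      ext i
      simpa using eq_of_vecMul_eq_self hP hirr hf.symm 0 i
    · rintro ⟨a, rfl⟩
      rw [Matrix.smul_vecMul, Matrix.one_vecMul_of_mem_colStochastic hP]
  rw [h]
  exact finrank_span_singleton one_ne_zero

lemma finrank_range_vecMul [NeZero k] (hP : P ∈ Matrix.colStochastic ℝ (Fin k))
    (hirr : P.IsIrreducible) :
    Module.finrank ℝ (LinearMap.range (1 - P).transpose.mulVecLin) + 1 = k := by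
  have h := LinearMap.finrank_range_add_finrank_ker (1 - P).transpose.mulVecLin
  rw [finrank_ker_vecMul hP hirr] at h
  simpa using h

/-- Row rank equals column rank, so the dimension count for left-invariant vectors carries over to
right-invariant ones. -/
lemma finrank_ker_mulVec [NeZero k] (hP : P ∈ Matrix.colStochastic ℝ (Fin k))
    (hirr : P.IsIrreducible) :
    Module.finrank ℝ (LinearMap.ker (1 - P).mulVecLin) = 1 := by
  have h := LinearMap.finrank_range_add_finrank_ker (1 - P).mulVecLin
  have h1 := finrank_range_vecMul hP hirr
  have h2 : Module.finrank ℝ (LinearMap.range (1 - P).transpose.mulVecLin) =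
    Module.finrank ℝ (LinearMap.range (1 - P).mulVecLin) := Matrix.rank_transpose (1 - P)
  rw [← h2] at h
  simp only [Module.finrank_fintype_fun_eq_card, Fintype.card_fin] at h
  omega

lemma mem_ker_one_sub_mulVecLin {v : Fin k → ℝ} :
    v ∈ LinearMap.ker (1 - P).mulVecLin ↔ P.mulVec v = v := by
  rw [LinearMap.mem_ker, Matrix.mulVecLin_apply, Matrix.sub_mulVec, Matrix.one_mulVec,
    sub_eq_zero, eq_comm]

/-- An irreducible column-stochastic matrix has exactly one invariant probability vector. -/
theorem existsUnique_isInvariantProbVector [NeZero k]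
    (hP : P ∈ Matrix.colStochastic ℝ (Fin k)) (hirr : P.IsIrreducible) :
    ∃! π, IsInvariantProbVector P π := by
  have hfin := finrank_ker_mulVec hP hirr
  obtain ⟨⟨v, hv⟩, hv0, hspan⟩ := finrank_eq_one_iff'.1 hfin
  have hPv := mem_ker_one_sub_mulVecLin.1 hv
  have hv0 : v ≠ 0 := fun h => hv0 (Subtype.ext h)
  -- The triangle inequality gives `|v| ≤ P |v|`; both sides have the same coordinate sum because
  -- columns sum to one, so equality holds.
  have habs_le : ∀ i, |v i| ≤ P.mulVec (fun j => |v j|) i := by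
    intro i
    calc |v i| = |∑ j, P i j * v j| := by rw [← congrFun hPv i]; rfl
      _ ≤ ∑ j, |P i j * v j| := Finset.abs_sum_le_sum_abs _ _
      _ = _ := by
        refine Finset.sum_congr rfl fun j _ => ?_
        rw [abs_mul, abs_of_nonneg (hP.1 i j)]
  have habs : P.mulVec (fun j => |v j|) = fun j => |v j| := by
    have hs : ∑ i, (P.mulVec (fun j => |v j|) i - |v i|) = 0 := by
      rw [Finset.sum_sub_distrib, Matrix.sum_mulVec_of_mem_colStochastic hP, sub_self]
    ext i
    have := (Finset.sum_eq_zero_iff_of_nonneg (fun i _ => sub_nonneg.2 (habs_le i))).1 hs i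
      (Finset.mem_univ i)
    linarith
  have hsum : 0 < ∑ i, |v i| := by
    obtain ⟨i, hi⟩ := Function.ne_iff.1 hv0
    exact Finset.sum_pos' (fun i _ => abs_nonneg _) ⟨i, Finset.mem_univ i, abs_pos.2 hi⟩
  refine ⟨(∑ i, |v i|)⁻¹ • fun j => |v j|, ⟨⟨fun i => ?_, ?_⟩, ?_⟩, ?_⟩
  · simp only [Pi.smul_apply, smul_eq_mul]
    positivity
  · simp only [Pi.smul_apply, smul_eq_mul, ← Finset.mul_sum]
    exact inv_mul_cancel₀ hsum.ne'
  · rw [Matrix.mulVec_smul, habs]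
  · rintro ρ ⟨⟨-, hρ1⟩, hρ⟩
    obtain ⟨a, ha⟩ := hspan ⟨ρ, mem_ker_one_sub_mulVecLin.2 hρ⟩
    obtain ⟨b, hb⟩ := hspan ⟨_, mem_ker_one_sub_mulVecLin.2 habs⟩
    have ha : ∀ i, a * v i = ρ i := fun i => congrFun (congrArg Subtype.val ha) i
    have hb : ∀ i, b * v i = |v i| := fun i => congrFun (congrArg Subtype.val hb) i
    have hs : b * ∑ i, v i = ∑ i, |v i| := by
      rw [Finset.mul_sum]; exact Finset.sum_congr rfl fun i _ => hb i
    have ht : a * ∑ i, v i = 1 := by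
      rw [← hρ1, Finset.mul_sum]; exact Finset.sum_congr rfl fun i _ => ha i
    ext i
    simp only [Pi.smul_apply, smul_eq_mul]
    rw [← hs, ← ha, ← hb]
    have hb0 : b ≠ 0 := by rintro rfl; simp [← hs] at hsum
    have hv1 : ∑ i, v i ≠ 0 := by intro h; simp [h] at ht
    have : a = (∑ i, v i)⁻¹ := eq_inv_of_mul_eq_one_left ht
    rw [this]
    field_simp

/-- The Poisson equation of an irreducible chain is solvable for centred functions. -/
theorem exists_poisson_solution [NeZero k] (hP : P ∈ Matrix.colStochastic ℝ (Fin k))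
    (hirr : P.IsIrreducible) {π : Fin k → ℝ} (hπ : IsInvariantProbVector P π)
    {g : Fin k → ℝ} (hg : ∑ j, π j * g j = 0) :
    ∃ h : Fin k → ℝ, ∀ j, h j - ∑ i, h i * P i j = g j := by
  let φ : (Fin k → ℝ) →ₗ[ℝ] ℝ := dotProductBilin ℝ ℝ π
  have hφ : ∀ f, φ f = ∑ j, π j * f j := fun f => rfl
  -- The range of `1 - Pᵀ` lies in the hyperplane orthogonal to `π`, and both have dimension `k -
  -- 1`.
  have hle : LinearMap.range (1 - P).transpose.mulVecLin ≤ LinearMap.ker φ := by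
    rintro _ ⟨f, rfl⟩
    rw [LinearMap.mem_ker]
    change π ⬝ᵥ ((1 - P).transpose.mulVec f) = 0
    rw [Matrix.dotProduct_mulVec, Matrix.vecMul_transpose, Matrix.sub_mulVec, Matrix.one_mulVec,
      hπ.2, sub_self, zero_dotProduct]
  have hker : Module.finrank ℝ (LinearMap.ker φ) + 1 = k := by
    have hsurj : LinearMap.range φ = ⊤ := by
      apply LinearMap.range_eq_top.2
      intro a
      refine ⟨fun _ => a, ?_⟩
      rw [hφ, ← Finset.sum_mul, hπ.1.2, one_mul]
    have h := LinearMap.finrank_range_add_finrank_ker φ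
    rw [hsurj] at h
    simp only [finrank_top, Module.finrank_self, Module.finrank_fintype_fun_eq_card,
      Fintype.card_fin] at h
    omega
  have heq := Submodule.eq_of_le_of_finrank_eq hle (by
    have := finrank_range_vecMul hP hirr
    omega)
  have hgm : g ∈ LinearMap.range (1 - P).transpose.mulVecLin := by
    rw [heq, LinearMap.mem_ker, hφ, hg]
  obtain ⟨h, hh⟩ := hgm
  refine ⟨h, fun j => ?_⟩
  rw [← hh, Matrix.mulVecLin_apply, Matrix.mulVec_transpose, Matrix.vecMul_sub, Matrix.vecMul_one]
  rfl

end Stochastic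

/-! ### Laws of Markov chains -/

section MarkovLaw

lemma measurable_prefixMap {α : Type*} [MeasurableSpace α] (n : ℕ) :
    Measurable (fun (ω : ℕ → α) (i : Fin n) => ω i) :=
  measurable_pi_lambda _ fun i => measurable_pi_apply (i : ℕ)

/-- A finite measure on sequences is determined by the laws of the finite prefixes. -/
lemma measure_ext_of_prefixes {α : Type*} [MeasurableSpace α] {m m' : Measure (ℕ → α)}
    [IsFiniteMeasure m]
    (h : ∀ (n : ℕ) (A : Set (Fin n → α)), MeasurableSet A →
      m {ω | (fun i : Fin n => ω i) ∈ A} = m' {ω | (fun i : Fin n => ω i) ∈ A}) : m = m' := by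
  refine ext_of_generate_finite (measurableCylinders fun _ : ℕ => α)
    generateFrom_measurableCylinders.symm isPiSystem_measurableCylinders ?_ ?_
  · intro T hT
    obtain ⟨s, S, hS, rfl⟩ := (mem_measurableCylinders T).1 hT
    -- A cylinder over a finite index set is an event about the prefix that reaches its largest
    -- index.
    have hlt : ∀ i : s, (i : ℕ) < s.sup id + 1 := fun i =>
      Nat.lt_succ_of_le (Finset.le_sup (f := id) i.2)
    exact h (s.sup id + 1) ((fun v (i : s) => v ⟨i, hlt i⟩) ⁻¹' S)
      ((measurable_pi_lambda _ fun i => measurable_pi_apply _) hS)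
  · simpa using h 0 Set.univ MeasurableSet.univ

variable {k : ℕ}

/-- The weight of a finite path of the Markov chain with initial vector `l`. -/
noncomputable def pathWeight (P : Matrix (Fin k) (Fin k) ℝ) (l : Fin k → ℝ) (n : ℕ)
    (s : Fin (n + 1) → Fin k) : ℝ :=
  l (s 0) * ∏ i : Fin n, P (s i.succ) (s i.castSucc)

variable {P : Matrix (Fin k) (Fin k) ℝ} {l : Fin k → ℝ}

lemma pathWeight_snoc (n : ℕ) (s : Fin (n + 1) → Fin k) (i : Fin k) :
    pathWeight P l (n + 1) (Fin.snoc s i : Fin (n + 2) → Fin k) =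
      pathWeight P l n s * P i (s (Fin.last n)) := by
  rw [pathWeight, pathWeight, Fin.prod_univ_castSucc, mul_assoc]
  simp only [Fin.succ_last, Fin.snoc_last, Fin.snoc_castSucc, Fin.succ_castSucc]
  rfl

/-- Forgetting the first state replaces the initial vector `l` by `P l`; this is what makes the
stationary law shift-invariant. -/
lemma sum_pathWeight_cons (hl : P.mulVec l = l) (n : ℕ) (s : Fin (n + 1) → Fin k) :
    ∑ j, pathWeight P l (n + 1) (Fin.cons j s : Fin (n + 2) → Fin k) = pathWeight P l n s := by
  have h : ∀ j, pathWeight P l (n + 1) (Fin.cons j s : Fin (n + 2) → Fin k) =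
      (P (s 0) j * l j) * ∏ i : Fin n, P (s i.succ) (s i.castSucc) := by
    intro j
    rw [pathWeight, Fin.prod_univ_succ]
    simp only [Fin.cons_zero, Fin.cons_succ, Fin.castSucc_zero, ← Fin.succ_castSucc]
    ring
  simp only [h, ← Finset.sum_mul]
  rw [pathWeight]
  congr 1
  exact congrFun hl (s 0)

lemma pathWeight_nonneg (hP : ∀ i j, 0 ≤ P i j) (hl : ∀ i, 0 ≤ l i) (n : ℕ)
    (s : Fin (n + 1) → Fin k) : 0 ≤ pathWeight P l n s :=
  mul_nonneg (hl _) (Finset.prod_nonneg fun _ _ => hP _ _)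

lemma sum_snoc {α M : Type*} [Fintype α] [AddCommMonoid M] (n : ℕ)
    (F : (Fin (n + 1) → α) → M) :
    ∑ s, F s = ∑ s : Fin n → α, ∑ i, F (Fin.snoc s i : Fin (n + 1) → α) := by
  rw [← (Fin.snocEquiv fun _ : Fin (n + 1) => α).sum_comp, Fintype.sum_prod_type,
    Finset.sum_comm]
  rfl

lemma sum_cons {α M : Type*} [Fintype α] [AddCommMonoid M] (n : ℕ)
    (F : (Fin (n + 1) → α) → M) :
    ∑ s, F s = ∑ s : Fin n → α, ∑ i, F (Fin.cons i s : Fin (n + 1) → α) := by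
  rw [← (Fin.consEquiv fun _ : Fin (n + 1) => α).sum_comp, Fintype.sum_prod_type,
    Finset.sum_comm]
  rfl

namespace IsMarkovLaw

variable {m m' : Measure (ℕ → Fin k)}

lemma map_prefix_singleton (hm : IsMarkovLaw P l m) (n : ℕ) (s : Fin (n + 1) → Fin k) :
    m.map (fun ω (i : Fin (n + 1)) => ω i) {s} = ENNReal.ofReal (pathWeight P l n s) := by
  rw [Measure.map_apply (measurable_prefixMap _) (measurableSet_singleton _), pathWeight, ← hm.2 n s]
  congr 1
  ext ω
  simp [funext_iff]

lemma measure_prefix_mem (hm : IsMarkovLaw P l m) (n : ℕ) (A : Set (Fin (n + 1) → Fin k)) :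
    m {ω | (fun i : Fin (n + 1) => ω i) ∈ A} =
      ∑ s, A.indicator (fun s => ENNReal.ofReal (pathWeight P l n s)) s := by
  classical
  have h1 : m {ω | (fun i : Fin (n + 1) => ω i) ∈ A} =
      m.map (fun ω (i : Fin (n + 1)) => ω i) (Finset.univ.filter (· ∈ A) : Finset _) := by
    rw [Measure.map_apply (measurable_prefixMap _) (Set.toFinite _).measurableSet]
    congr 1
    ext ω
    simp
  rw [h1, ← sum_measure_singleton, Finset.sum_filter]
  refine Finset.sum_congr rfl fun s _ => ?_
  by_cases hs : s ∈ A <;> simp [hs, hm.map_prefix_singleton]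

lemma integral_prefix_comp (hm : IsMarkovLaw P l m) (hP : ∀ i j, 0 ≤ P i j) (hl : ∀ i, 0 ≤ l i)
    (n : ℕ) (F : (Fin (n + 1) → Fin k) → ℝ) :
    ∫ ω, F (fun i => ω i) ∂m = ∑ s, pathWeight P l n s * F s := by
  have := hm.1
  have : IsFiniteMeasure (m.map fun ω (i : Fin (n + 1)) => ω i) :=
    Measure.isFiniteMeasure_map _ _
  have h1 := integral_map (measurable_prefixMap (α := Fin k) (n + 1)).aemeasurable (μ := m)
    (f := F) (Measurable.of_discrete).aestronglyMeasurable
  rw [← h1, integral_fintype Integrable.of_finite]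
  refine Finset.sum_congr rfl fun s _ => ?_
  rw [Measure.real, hm.map_prefix_singleton, ENNReal.toReal_ofReal (pathWeight_nonneg hP hl n s),
    smul_eq_mul]

protected lemma unique (hm : IsMarkovLaw P l m) (hm' : IsMarkovLaw P l m') : m = m' := by
  have := hm.1
  have := hm'.1
  refine measure_ext_of_prefixes fun n A _ => ?_
  cases n with
  -- `IsMarkovLaw` prescribes only nonempty prefixes; for the empty one the event is everything or
  -- nothing.
  | zero =>
    by_cases h : (Fin.elim0 : Fin 0 → Fin k) ∈ A
    · have : ∀ ω : ℕ → Fin k, (fun i : Fin 0 => ω i) ∈ A := fun ω => by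
        convert h
      simp [this]
    · have : ∀ ω : ℕ → Fin k, (fun i : Fin 0 => ω i) ∉ A := fun ω hω => h (by
        convert hω)
      simp [this]
  | succ n => rw [hm.measure_prefix_mem, hm'.measure_prefix_mem]

lemma measurable_seqShift {α : Type*} [MeasurableSpace α] :
    Measurable (seqShift : (ℕ → α) → ℕ → α) :=
  measurable_pi_lambda _ fun n => measurable_pi_apply (n + 1)

lemma map_seqShift (hm : IsMarkovLaw P l m) (hP : ∀ i j, 0 ≤ P i j) (hl : ∀ i, 0 ≤ l i)
    (hinv : P.mulVec l = l) : IsMarkovLaw P l (m.map seqShift) := by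
  have := hm.1
  refine ⟨Measure.isProbabilityMeasure_map measurable_seqShift.aemeasurable, fun n s => ?_⟩
  have hcyl : MeasurableSet {ω : ℕ → Fin k | ∀ i : Fin (n + 1), ω i = s i} := by
    have h : {ω : ℕ → Fin k | ∀ i : Fin (n + 1), ω i = s i} =
        (fun ω (i : Fin (n + 1)) => ω i) ⁻¹' {s} := by
      ext ω; simp [funext_iff]
    rw [h]
    exact measurable_prefixMap _ (measurableSet_singleton _)
  rw [Measure.map_apply measurable_seqShift hcyl]
  have h2 : seqShift ⁻¹' {ω : ℕ → Fin k | ∀ i : Fin (n + 1), ω i = s i} =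
      {ω | (fun i : Fin (n + 2) => ω i) ∈ {t : Fin (n + 2) → Fin k | Fin.tail t = s}} := by
    ext ω
    simp [funext_iff, seqShift, Fin.tail]
  rw [h2, hm.measure_prefix_mem, sum_cons, Finset.sum_eq_single s]
  · rw [← pathWeight, ← sum_pathWeight_cons hinv,
      ENNReal.ofReal_sum_of_nonneg fun j _ => pathWeight_nonneg hP hl _ _]
    refine Finset.sum_congr rfl fun j _ => ?_
    simp
  · intro t _ hts
    refine Finset.sum_eq_zero fun j _ => ?_
    simp [hts]
  · simp

lemma measurePreserving_seqShift (hm : IsMarkovLaw P l m) (hP : ∀ i j, 0 ≤ P i j)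
    (hl : ∀ i, 0 ≤ l i) (hinv : P.mulVec l = l) : MeasurePreserving seqShift m m :=
  ⟨measurable_seqShift, (hm.map_seqShift hP hl hinv).unique hm⟩

end IsMarkovLaw

/-- The measure on `Fin k` with weights `p`. -/
noncomputable def finMeasure (p : Fin k → ℝ) : Measure (Fin k) :=
  ∑ i, ENNReal.ofReal (p i) • Measure.dirac i

lemma finMeasure_singleton (p : Fin k → ℝ) (i : Fin k) :
    finMeasure p {i} = ENNReal.ofReal (p i) := by
  classical
  rw [finMeasure, Measure.finsetSum_apply, Finset.sum_eq_single i]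
  · simp
  · intro j _ hj
    simp [hj]
  · simp

lemma isProbabilityMeasure_finMeasure {p : Fin k → ℝ} (hp : p ∈ stdSimplex ℝ (Fin k)) :
    IsProbabilityMeasure (finMeasure p) := by
  refine ⟨?_⟩
  rw [finMeasure, Measure.finsetSum_apply]
  simp only [Measure.smul_apply, measure_univ, smul_eq_mul, mul_one]
  rw [← ENNReal.ofReal_sum_of_nonneg fun i _ => hp.1 i, hp.2, ENNReal.ofReal_one]

/-- The orbit `x, f₀ x, f₁ (f₀ x), …` of a point under a sequence of maps. -/
def composedOrbit {α : Type*} (z : α × (ℕ → α → α)) : ℕ → α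
  | 0 => z.1
  | n + 1 => z.2 n (composedOrbit z n)

lemma measurable_composedOrbit :
    Measurable (composedOrbit : Fin k × (ℕ → Fin k → Fin k) → ℕ → Fin k) := by
  refine measurable_pi_lambda _ fun n => ?_
  induction n with
  | zero => exact measurable_fst
  | succ n ih =>
    have h1 : Measurable fun z : Fin k × (ℕ → Fin k → Fin k) => z.2 n :=
      (measurable_pi_apply n).comp measurable_snd
    exact (Measurable.of_discrete (f := fun q : (Fin k → Fin k) × Fin k => q.1 q.2)).comp
      (h1.prodMk ih)

/-- The Markov chain with a given initial law exists: iterate independent random maps. -/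
theorem exists_isMarkovLaw (hP : P ∈ Matrix.colStochastic ℝ (Fin k))
    (hl : l ∈ stdSimplex ℝ (Fin k)) : ∃ m, IsMarkovLaw P l m := by
  have hcol : ∀ j, (fun i => P i j) ∈ stdSimplex ℝ (Fin k) := fun j =>
    ⟨fun i => hP.1 i j, Matrix.sum_col_of_mem_colStochastic hP j⟩
  have := fun j => isProbabilityMeasure_finMeasure (hcol j)
  have := isProbabilityMeasure_finMeasure hl
  -- A random map that sends each `j` to `i` with probability `P i j`, independently over `j`.
  let ρ : Measure (Fin k → Fin k) := Measure.pi fun j => finMeasure fun i => P i j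
  refine ⟨((finMeasure l).prod (Measure.infinitePi fun _ : ℕ => ρ)).map composedOrbit,
    Measure.isProbabilityMeasure_map measurable_composedOrbit.aemeasurable, fun n s => ?_⟩
  have hcyl : MeasurableSet {ω : ℕ → Fin k | ∀ i : Fin (n + 1), ω i = s i} := by
    have h : {ω : ℕ → Fin k | ∀ i : Fin (n + 1), ω i = s i} =
        (fun ω (i : Fin (n + 1)) => ω i) ⁻¹' {s} := by
      ext ω; simp [funext_iff]
    rw [h]
    exact measurable_prefixMap _ (measurableSet_singleton _)
  -- Following the path `s` constrains the `i`-th map only at the point `s i`, so the path event is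
  -- a product set.
  let t : ℕ → Set (Fin k → Fin k) := fun i =>
    if h : i < n then {g | g (s ⟨i, by omega⟩) = s ⟨i + 1, by omega⟩} else Set.univ
  have hpre : composedOrbit ⁻¹' {ω : ℕ → Fin k | ∀ i : Fin (n + 1), ω i = s i} =
      {s 0} ×ˢ Set.pi (Finset.range n : Set ℕ) t := by
    ext ⟨x, f⟩
    simp only [Set.mem_preimage, Set.mem_ofPred_eq, Set.mem_prod, Set.mem_singleton_iff, Set.mem_pi,
      Finset.coe_range, Set.mem_Iio]
    constructor
    · intro h
      refine ⟨h 0, fun i hi => ?_⟩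
      simp only [t, hi, dif_pos, Set.mem_ofPred_eq]
      have h1 := h ⟨i, by omega⟩
      have h2 := h ⟨i + 1, by omega⟩
      rw [← h1, ← h2]
      rfl
    · rintro ⟨h0, h⟩ ⟨i, hi⟩
      induction i with
      | zero => exact h0
      | succ i ih =>
        have h1 := h i (by omega)
        simp only [t, show i < n by omega, dif_pos, Set.mem_ofPred_eq] at h1
        have h2 := ih (by omega)
        simp only at h2
        simp only [composedOrbit]
        rw [h2, h1]
  rw [Measure.map_apply measurable_composedOrbit hcyl, hpre, Measure.prod_prod,
    finMeasure_singleton, Measure.infinitePi_pi _ (fun _ _ => (Set.toFinite _).measurableSet),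
    ENNReal.ofReal_mul (hl.1 _), ENNReal.ofReal_prod_of_nonneg fun _ _ => hP.1 _ _,
    Finset.prod_range]
  congr 1
  refine Finset.prod_congr rfl fun i _ => ?_
  have h1 : t i = (fun g => g (s i.castSucc)) ⁻¹' {s i.succ} := by
    simp only [t, i.2, dif_pos]
    rfl
  rw [h1, ((measurePreserving_eval (fun j => finMeasure fun i => P i j)
    (s i.castSucc)).measure_preimage (measurableSet_singleton _).nullMeasurableSet),
    finMeasure_singleton]

end MarkovLaw

/-! ### The strong law of large numbers for irreducible Markov chains -/

section StrongLaw

variable {k : ℕ} {P : Matrix (Fin k) (Fin k) ℝ} {l : Fin k → ℝ} {m : Measure (ℕ → Fin k)}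

lemma Real.exp_le_one_add_add_sq {x : ℝ} (hx : |x| ≤ 1) : Real.exp x ≤ 1 + x + x ^ 2 := by
  have := (abs_le.1 (Real.abs_exp_sub_one_sub_id_le hx)).2
  linarith

/-- Given the present state, an increment has mean zero and `|t d| ≤ t C ≤ 1`, so `exp x ≤ 1 + x +
x²` bounds its exponential moment by `1 + (t C)² ≤ exp ((t C)²)`. These factors multiply along the
path. -/
lemma sum_pathWeight_mul_exp_le (hP : P ∈ Matrix.colStochastic ℝ (Fin k))
    (hl : l ∈ stdSimplex ℝ (Fin k)) {d : Fin k → Fin k → ℝ} {C t : ℝ}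
    (hd : ∀ j, ∑ i, P i j * d i j = 0) (hC : ∀ i j, |d i j| ≤ C) (ht : 0 ≤ t) (htC : t * C ≤ 1)
    (n : ℕ) :
    ∑ s, pathWeight P l n s * Real.exp (t * ∑ i : Fin n, d (s i.succ) (s i.castSucc)) ≤
      Real.exp (n * (t * C) ^ 2) := by
  have hstep : ∀ j, ∑ i, P i j * Real.exp (t * d i j) ≤ Real.exp ((t * C) ^ 2) := by
    intro j
    have h1 : ∀ i, P i j * Real.exp (t * d i j) ≤
        P i j + t * (P i j * d i j) + P i j * (t * C) ^ 2 := by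
      intro i
      have habs : |t * d i j| ≤ t * C := by
        rw [abs_mul, abs_of_nonneg ht]
        exact mul_le_mul_of_nonneg_left (hC i j) ht
      have h2 := Real.exp_le_one_add_add_sq (habs.trans htC)
      have h3 : (t * d i j) ^ 2 ≤ (t * C) ^ 2 := by
        rw [← sq_abs]
        exact pow_le_pow_left₀ (abs_nonneg _) habs 2
      calc P i j * Real.exp (t * d i j) ≤ P i j * (1 + t * d i j + (t * C) ^ 2) :=
            mul_le_mul_of_nonneg_left (by linarith) (hP.1 i j)
        _ = _ := by ring
    calc ∑ i, P i j * Real.exp (t * d i j)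
        ≤ ∑ i, (P i j + t * (P i j * d i j) + P i j * (t * C) ^ 2) :=
          Finset.sum_le_sum fun i _ => h1 i
      _ = (t * C) ^ 2 + 1 := by
        rw [Finset.sum_add_distrib, Finset.sum_add_distrib, ← Finset.mul_sum, hd,
          ← Finset.sum_mul, Matrix.sum_col_of_mem_colStochastic hP]
        ring
      _ ≤ _ := Real.add_one_le_exp _
  induction n with
  | zero =>
    rw [← (Equiv.funUnique (Fin 1) (Fin k)).symm.sum_comp]
    simp [pathWeight, hl.2]
  | succ n ih =>
    rw [sum_snoc]
    calc _ = ∑ s, pathWeight P l n s *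
          Real.exp (t * ∑ i : Fin n, d (s i.succ) (s i.castSucc)) *
            ∑ i, P i (s (Fin.last n)) * Real.exp (t * d i (s (Fin.last n))) := by
          refine Finset.sum_congr rfl fun s _ => ?_
          rw [Finset.mul_sum]
          refine Finset.sum_congr rfl fun i _ => ?_
          rw [pathWeight_snoc, Fin.sum_univ_castSucc]
          simp only [Fin.succ_last, Fin.snoc_last, Fin.snoc_castSucc, Fin.succ_castSucc]
          rw [mul_add, Real.exp_add]
          ring
      _ ≤ ∑ s, pathWeight P l n s *
          Real.exp (t * ∑ i : Fin n, d (s i.succ) (s i.castSucc)) * Real.exp ((t * C) ^ 2) :=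
          Finset.sum_le_sum fun s _ => mul_le_mul_of_nonneg_left (hstep _)
            (mul_nonneg (pathWeight_nonneg hP.1 hl.1 _ _) (Real.exp_pos _).le)
      _ ≤ Real.exp (n * (t * C) ^ 2) * Real.exp ((t * C) ^ 2) := by
          rw [← Finset.sum_mul]
          exact mul_le_mul_of_nonneg_right ih (Real.exp_pos _).le
      _ = _ := by
          rw [← Real.exp_add]
          push_cast
          ring_nf

/-- Markov's inequality for the exponential moment gives geometrically small tails, and
Borel–Cantelli concludes. -/
lemma IsMarkovLaw.ae_eventually_sum_lt (hP : P ∈ Matrix.colStochastic ℝ (Fin k))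
    (hl : l ∈ stdSimplex ℝ (Fin k)) (hm : IsMarkovLaw P l m) {d : Fin k → Fin k → ℝ}
    (hd : ∀ j, ∑ i, P i j * d i j = 0) {ε : ℝ} (hε : 0 < ε) :
    ∀ᵐ ω ∂m, ∀ᶠ n : ℕ in atTop,
      ∑ i ∈ Finset.range n, d (ω (i + 1)) (ω i) < ε * n := by
  have := hm.1
  obtain ⟨C, hC1, hC⟩ : ∃ C : ℝ, 1 ≤ C ∧ ∀ i j, |d i j| ≤ C := by
    refine ⟨1 + ∑ i, ∑ j, |d i j|, ?_, fun i j => ?_⟩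
    · have : 0 ≤ ∑ i, ∑ j, |d i j| :=
        Finset.sum_nonneg fun i _ => Finset.sum_nonneg fun j _ => abs_nonneg _
      linarith
    · have h1 : |d i j| ≤ ∑ j, |d i j| :=
        Finset.single_le_sum (f := fun j => |d i j|) (fun j _ => abs_nonneg _) (Finset.mem_univ j)
      have h2 : ∑ j, |d i j| ≤ ∑ i, ∑ j, |d i j| :=
        Finset.single_le_sum (f := fun i => ∑ j, |d i j|)
          (fun i _ => Finset.sum_nonneg fun j _ => abs_nonneg _) (Finset.mem_univ i)
      linarith
  have hC0 : 0 < C := by linarith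
  -- The first bound yields `t C ≤ 1`; the second makes the quadratic cost `(t C)²` at most half of
  -- the linear gain `t ε`.
  let t : ℝ := min (1 / C) (ε / (2 * C ^ 2))
  have ht : 0 < t := by positivity
  have htC : t * C ≤ 1 := by
    calc t * C ≤ 1 / C * C := mul_le_mul_of_nonneg_right (min_le_left _ _) hC0.le
      _ = 1 := by field_simp
  have htC2 : t * C ^ 2 ≤ ε / 2 := by
    calc t * C ^ 2 ≤ ε / (2 * C ^ 2) * C ^ 2 :=
          mul_le_mul_of_nonneg_right (min_le_right _ _) (by positivity)
      _ = ε / 2 := by field_simp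
  let M : ℕ → (ℕ → Fin k) → ℝ := fun n ω => ∑ i ∈ Finset.range n, d (ω (i + 1)) (ω i)
  have hM : ∀ n ω, M n ω = (fun s : Fin (n + 1) → Fin k =>
      ∑ i : Fin n, d (s i.succ) (s i.castSucc)) (fun i => ω i) := by
    intro n ω
    simp only [M, Finset.sum_range]
    rfl
  have hbound : ∀ n : ℕ, m {ω | ε * n ≤ M n ω} ≤
      ENNReal.ofReal (Real.exp (-(t * ε / 2)) ^ n) := by
    intro n
    have hint : Integrable (fun ω => Real.exp (t * M n ω)) m := by
      have hmeas : Measurable fun ω => Real.exp (t * M n ω) := by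
        simp only [hM]
        exact (Measurable.of_discrete (f := fun s : Fin (n + 1) → Fin k =>
          Real.exp (t * ∑ i : Fin n, d (s i.succ) (s i.castSucc)))).comp (measurable_prefixMap _)
      refine Integrable.of_bound hmeas.aestronglyMeasurable (Real.exp (t * (n * C)))
        (Eventually.of_forall fun ω => ?_)
      rw [Real.norm_eq_abs, Real.abs_exp]
      refine Real.exp_le_exp.2 (mul_le_mul_of_nonneg_left ?_ ht.le)
      calc M n ω ≤ ∑ i ∈ Finset.range n, C :=
            Finset.sum_le_sum fun i _ => (le_abs_self _).trans (hC _ _)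
        _ = n * C := by simp
    have h1 := ProbabilityTheory.measure_ge_le_exp_mul_mgf (ε * n) ht.le hint
    have h2 : ProbabilityTheory.mgf (M n) m t ≤ Real.exp (n * (t * C) ^ 2) := by
      rw [ProbabilityTheory.mgf]
      simp only [hM]
      rw [hm.integral_prefix_comp hP.1 hl.1 n (fun s =>
        Real.exp (t * ∑ i : Fin n, d (s i.succ) (s i.castSucc)))]
      exact sum_pathWeight_mul_exp_le hP hl hd hC ht.le htC n
    rw [← ofReal_measureReal (measure_ne_top _ _)]
    refine ENNReal.ofReal_le_ofReal (h1.trans ?_)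
    calc _ ≤ Real.exp (-t * (ε * n)) * Real.exp (n * (t * C) ^ 2) :=
          mul_le_mul_of_nonneg_left h2 (Real.exp_pos _).le
      _ ≤ _ := by
        rw [← Real.exp_add, ← Real.exp_nat_mul]
        refine Real.exp_le_exp.2 ?_
        have h3 : (t * C) ^ 2 ≤ t * (ε / 2) := by
          calc (t * C) ^ 2 = t * (t * C ^ 2) := by ring
            _ ≤ _ := mul_le_mul_of_nonneg_left htC2 ht.le
        have h4 := mul_le_mul_of_nonneg_left h3 (Nat.cast_nonneg (α := ℝ) n)
        linarith
  have hsum : ∑' n : ℕ, m {ω | ε * n ≤ M n ω} ≠ ∞ := by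
    refine ne_top_of_le_ne_top ?_ (ENNReal.tsum_le_tsum hbound)
    have hr : Real.exp (-(t * ε / 2)) < 1 := by
      rw [Real.exp_lt_one_iff]
      have : 0 < t * ε / 2 := by positivity
      linarith
    exact (summable_geometric_of_lt_one (Real.exp_pos _).le hr).tsum_ofReal_ne_top
  filter_upwards [ae_eventually_notMem hsum] with ω hω
  filter_upwards [hω] with n hn
  simpa using hn

/-- The one-sided bound is used for `d` and `-d` with the thresholds `1 / (q + 1)`, so that only
countably many null sets are discarded. -/
lemma IsMarkovLaw.ae_tendsto_average_zero (hP : P ∈ Matrix.colStochastic ℝ (Fin k))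
    (hl : l ∈ stdSimplex ℝ (Fin k)) (hm : IsMarkovLaw P l m) {d : Fin k → Fin k → ℝ}
    (hd : ∀ j, ∑ i, P i j * d i j = 0) :
    ∀ᵐ ω ∂m, Tendsto (fun n : ℕ => (1 / (n : ℝ)) * ∑ i ∈ Finset.range n, d (ω (i + 1)) (ω i))
      atTop (𝓝 0) := by
  have hd' : ∀ j, ∑ i, P i j * (fun i j => -d i j) i j = 0 := by
    intro j
    simp only [mul_neg, Finset.sum_neg_distrib, hd, neg_zero]
  have h1 := ae_all_iff.2 fun q : ℕ => hm.ae_eventually_sum_lt hP hl hd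
    (Nat.one_div_pos_of_nat (α := ℝ) (n := q))
  have h2 := ae_all_iff.2 fun q : ℕ => hm.ae_eventually_sum_lt hP hl hd'
    (Nat.one_div_pos_of_nat (α := ℝ) (n := q))
  filter_upwards [h1, h2] with ω hω1 hω2
  rw [Metric.tendsto_atTop']
  intro ε hε
  obtain ⟨q, hq⟩ := exists_nat_one_div_lt hε
  obtain ⟨N, hN⟩ := ((hω1 q).and ((hω2 q).and (eventually_gt_atTop 0))).exists_forall_of_atTop
  refine ⟨N, fun n hn => ?_⟩
  obtain ⟨ha, hb, hn0⟩ := hN n hn.le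
  have hn0 : (0 : ℝ) < n := by exact_mod_cast hn0
  rw [Finset.sum_neg_distrib] at hb
  rw [Real.dist_eq, sub_zero, one_div_mul_eq_div, abs_div, abs_of_pos hn0, div_lt_iff₀ hn0]
  have : 1 / ((q : ℝ) + 1) * n < ε * n := mul_lt_mul_of_pos_right hq hn0
  rw [abs_lt]
  constructor <;> linarith

/-- The strong law of large numbers for the transitions of an irreducible Markov chain. -/
theorem IsMarkovLaw.ae_tendsto_average [NeZero k] (hP : P ∈ Matrix.colStochastic ℝ (Fin k))
    (hirr : P.IsIrreducible) {π : Fin k → ℝ} (hπ : IsInvariantProbVector P π)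
    (hl : l ∈ stdSimplex ℝ (Fin k)) (hm : IsMarkovLaw P l m) (f : Fin k → Fin k → ℝ) :
    ∀ᵐ ω ∂m, Tendsto (fun n : ℕ => (1 / (n : ℝ)) * ∑ i ∈ Finset.range n, f (ω (i + 1)) (ω i))
      atTop (𝓝 (∑ i, ∑ j, π j * P i j * f i j)) := by
  set c := ∑ i, ∑ j, π j * P i j * f i j with hc
  obtain ⟨h, hh⟩ := exists_poisson_solution hP hirr hπ
    (g := fun j => ∑ i, P i j * f i j - c) (by
      simp only [mul_sub, Finset.sum_sub_distrib, ← Finset.sum_mul, hπ.1.2, Finset.mul_sum]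
      rw [Finset.sum_comm, hc, one_mul, sub_eq_zero]
      exact Finset.sum_congr rfl fun i _ => Finset.sum_congr rfl fun j _ => by ring)
  -- The Poisson equation says exactly that these corrected increments are centred; the `h` terms
  -- telescope to a bounded quantity.
  have hd : ∀ j, ∑ i, P i j * (fun i j => f i j - c + h i - h j) i j = 0 := by
    intro j
    have h1 := Matrix.sum_col_of_mem_colStochastic hP j
    have h2 := hh j
    simp only [mul_sub, mul_add, Finset.sum_sub_distrib, Finset.sum_add_distrib, ← Finset.sum_mul,
      h1, one_mul]
    simp only [mul_comm (h _)] at h2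
    linarith
  filter_upwards [hm.ae_tendsto_average_zero hP hl hd] with ω hω
  have hsum : ∀ n : ℕ, ∑ i ∈ Finset.range n, (f (ω (i + 1)) (ω i) - c + h (ω (i + 1)) - h (ω i)) =
      ∑ i ∈ Finset.range n, f (ω (i + 1)) (ω i) - n * c + (h (ω n) - h (ω 0)) := by
    intro n
    rw [← Finset.sum_range_sub (fun i => h (ω i)) n]
    simp only [Finset.sum_sub_distrib, Finset.sum_add_distrib, Finset.sum_const, Finset.card_range,
      nsmul_eq_mul]
    ring
  have hbdd : Tendsto (fun n : ℕ => (1 / (n : ℝ)) * (h (ω n) - h (ω 0))) atTop (𝓝 0) := by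
    refine tendsto_one_div_atTop_nhds_zero_nat.zero_mul_isBoundedUnder_le ?_
    refine isBoundedUnder_of ⟨∑ i, |h i| + |h (ω 0)|, fun n => ?_⟩
    simp only [Function.comp_apply, Real.norm_eq_abs]
    refine (abs_sub _ _).trans (add_le_add ?_ le_rfl)
    exact Finset.single_le_sum (f := fun i => |h i|) (fun i _ => abs_nonneg _) (Finset.mem_univ _)
  have h3 := (hω.sub hbdd).add_const c
  rw [sub_zero, zero_add] at h3
  refine h3.congr' ?_
  filter_upwards [eventually_gt_atTop 0] with n hn
  have hn0 : (n : ℝ) ≠ 0 := by exact_mod_cast hn.ne'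
  simp only [hsum]
  field_simp
  ring

end StrongLaw

/-! ### Entropy of finite partitions -/

section PartitionEntropy

/-- The Shannon entropy of one marginal of a finite joint law, bounded through the other marginal
and any positive stochastic kernel `R`. -/
lemma sum_negMulLog_le_of_kernel {α β : Type*} [Fintype α] [Fintype β] {p : α → β → ℝ}
    (hp : ∀ a b, 0 ≤ p a b) (hp1 : ∑ a, ∑ b, p a b = 1) {R : β → α → ℝ}
    (hR : ∀ b a, 0 < R b a) (hR1 : ∀ b, ∑ a, R b a = 1) :
    ∑ a, Real.negMulLog (∑ b, p a b) ≤
      ∑ b, Real.negMulLog (∑ a, p a b) - ∑ a, ∑ b, p a b * Real.log (R b a) := by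
  set pA : α → ℝ := fun a => ∑ b, p a b with hpA
  set pB : β → ℝ := fun b => ∑ a, p a b with hpB
  have hA : ∀ a b, p a b ≤ pA a := fun a b =>
    Finset.single_le_sum (f := fun b => p a b) (fun b _ => hp a b) (Finset.mem_univ b)
  have hB : ∀ a b, p a b ≤ pB b := fun a b =>
    Finset.single_le_sum (f := fun a => p a b) (fun a _ => hp a b) (Finset.mem_univ a)
  have hB0 : ∀ b, 0 ≤ pB b := fun b => Finset.sum_nonneg fun a _ => hp a b
  -- Gibbs' inequality term by term: `log x ≤ x - 1` at `x = pB b * R b a / pA a`, followed by `p a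
  -- b ≤ pA a`. The terms `pB b * R b a` and `p a b` both have total mass one, so the right sides
  -- sum to zero.
  have hkey : ∀ a b, p a b * (Real.log (pB b) + Real.log (R b a) - Real.log (pA a)) ≤
      pB b * R b a - p a b := by
    intro a b
    rcases (hp a b).eq_or_lt with h0 | h0
    · rw [← h0]
      have := mul_nonneg (hB0 b) (hR b a).le
      linarith
    · have hpa : 0 < pA a := h0.trans_le (hA a b)
      have hpb : 0 < pB b := h0.trans_le (hB a b)
      have hpos : 0 < pB b * R b a := mul_pos hpb (hR b a)
      rw [← Real.log_mul hpb.ne' (hR b a).ne', ← Real.log_div hpos.ne' hpa.ne']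
      have h1 := Real.log_le_sub_one_of_pos (div_pos hpos hpa)
      calc p a b * Real.log (pB b * R b a / pA a)
          ≤ p a b * (pB b * R b a / pA a - 1) := mul_le_mul_of_nonneg_left h1 h0.le
        _ = p a b / pA a * (pB b * R b a) - p a b := by ring
        _ ≤ 1 * (pB b * R b a) - p a b := by
          have : p a b / pA a ≤ 1 := (div_le_one hpa).2 (hA a b)
          have := mul_le_mul_of_nonneg_right this hpos.le
          linarith
        _ = _ := by ring
  have hsum : ∑ a, ∑ b, p a b * (Real.log (pB b) + Real.log (R b a) - Real.log (pA a)) ≤ 0 := by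
    calc _ ≤ ∑ a, ∑ b, (pB b * R b a - p a b) :=
          Finset.sum_le_sum fun a _ => Finset.sum_le_sum fun b _ => hkey a b
      _ = 0 := by
        simp only [Finset.sum_sub_distrib]
        rw [Finset.sum_comm]
        simp only [← Finset.mul_sum, hR1, mul_one, hpB]
        rw [Finset.sum_comm, hp1, sub_self]
  have e1 : ∑ a, Real.negMulLog (pA a) = -∑ a, ∑ b, p a b * Real.log (pA a) := by
    simp only [Real.negMulLog, ← Finset.sum_mul, neg_mul, Finset.sum_neg_distrib, hpA]
  have e2 : ∑ b, Real.negMulLog (pB b) = -∑ a, ∑ b, p a b * Real.log (pB b) := by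
    rw [Finset.sum_comm]
    simp only [Real.negMulLog, ← Finset.sum_mul, neg_mul, Finset.sum_neg_distrib, hpB]
  rw [e1, e2]
  simp only [mul_sub, mul_add, Finset.sum_sub_distrib, Finset.sum_add_distrib] at hsum
  linarith

/-- To be used with `B` a long prefix and `R` a randomized guess of `A` from `B`; the integral is
the expected logarithmic loss of the guess. -/
lemma partitionEntropy_le_of_kernel {X α β : Type*} [MeasurableSpace X] [Fintype α] [Fintype β]
    [MeasurableSpace α] [MeasurableSingletonClass α] [MeasurableSpace β]
    [MeasurableSingletonClass β] {m : Measure X} [IsProbabilityMeasure m] {A : X → α} {B : X → β}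
    (hA : Measurable A) (hB : Measurable B) {R : β → α → ℝ}
    (hR : ∀ b a, 0 < R b a) (hR1 : ∀ b, ∑ a, R b a = 1) :
    partitionEntropy m A ≤ partitionEntropy m B - ∫ x, Real.log (R (B x) (A x)) ∂m := by
  classical
  have hAB : Measurable fun x => (A x, B x) := hA.prodMk hB
  have : IsProbabilityMeasure (m.map fun x => (A x, B x)) :=
    Measure.isProbabilityMeasure_map hAB.aemeasurable
  have hpAB : ∀ s : Finset (α × β), (m.map fun x => (A x, B x)).real (s : Set (α × β)) =
      ∑ q ∈ s, (m.map fun x => (A x, B x)).real {q} := fun s =>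
    (sum_measureReal_singleton (μ := m.map fun x => (A x, B x)) s).symm
  have h1 : ∀ a, m.real (A ⁻¹' {a}) = ∑ b, (m.map fun x => (A x, B x)).real {(a, b)} := by
    intro a
    have h := hpAB ({a} ×ˢ Finset.univ)
    rw [map_measureReal_apply hAB (Finset.measurableSet _), Finset.sum_product] at h
    simp only [Finset.sum_singleton] at h
    rw [← h]
    congr 1
    ext x
    simp [eq_comm]
  have h2 : ∀ b, m.real (B ⁻¹' {b}) = ∑ a, (m.map fun x => (A x, B x)).real {(a, b)} := by
    intro b
    have h := hpAB (Finset.univ ×ˢ {b})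
    rw [map_measureReal_apply hAB (Finset.measurableSet _), Finset.sum_product] at h
    simp only [Finset.sum_singleton] at h
    rw [← h]
    congr 1
    ext x
    simp [eq_comm]
  have h3 : ∑ a, ∑ b, (m.map fun x => (A x, B x)).real {(a, b)} = 1 := by
    have h := hpAB Finset.univ
    rw [Fintype.sum_prod_type] at h
    rw [← h]
    simp
  have h4 : ∫ x, Real.log (R (B x) (A x)) ∂m =
      ∑ a, ∑ b, (m.map fun x => (A x, B x)).real {(a, b)} * Real.log (R b a) := by
    have h := integral_map hAB.aemeasurable (μ := m)
      (f := fun q : α × β => Real.log (R q.2 q.1)) (Measurable.of_discrete).aestronglyMeasurable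
    rw [← h, integral_fintype Integrable.of_finite, Fintype.sum_prod_type]
    rfl
  rw [partitionEntropy, partitionEntropy, h4]
  simp only [h1, h2]
  exact sum_negMulLog_le_of_kernel (fun _ _ => measureReal_nonneg) h3 hR hR1

end PartitionEntropy

/-! ### Entropy of a stationary Markov chain -/

section MarkovEntropy

variable {k : ℕ} {P : Matrix (Fin k) (Fin k) ℝ} {π : Fin k → ℝ} {m : Measure (ℕ → Fin k)}

/-- The Shannon entropy rate `-∑ π_j p_ij log p_ij` of a stationary chain. -/
noncomputable def entropyRate (P : Matrix (Fin k) (Fin k) ℝ) (π : Fin k → ℝ) : ℝ :=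
  -∑ i, ∑ j, π j * P i j * Real.log (P i j)

lemma sum_pathWeight_mul_last (hπ : IsInvariantProbVector P π) (n : ℕ) (F : Fin k → ℝ) :
    ∑ s, pathWeight P π n s * F (s (Fin.last n)) = ∑ j, π j * F j := by
  induction n generalizing F with
  | zero =>
    rw [← (Equiv.funUnique (Fin 1) (Fin k)).symm.sum_comp]
    simp [pathWeight]
  | succ n ih =>
    rw [sum_snoc]
    have h1 : ∀ s : Fin (n + 1) → Fin k,
        ∑ i, pathWeight P π (n + 1) (Fin.snoc s i : Fin (n + 2) → Fin k) *
          F ((Fin.snoc s i : Fin (n + 2) → Fin k) (Fin.last (n + 1))) =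
        pathWeight P π n s * (fun j => ∑ i, P i j * F i) (s (Fin.last n)) := by
      intro s
      simp only [Finset.mul_sum, pathWeight_snoc, Fin.snoc_last, mul_assoc]
    rw [Finset.sum_congr rfl fun s _ => h1 s, ih fun j => ∑ i, P i j * F i]
    have h2 : ∀ i, ∑ j, P i j * π j = π i := fun i => congrFun hπ.2 i
    simp only [Finset.mul_sum]
    rw [Finset.sum_comm]
    refine Finset.sum_congr rfl fun i _ => ?_
    rw [← h2 i, Finset.sum_mul]
    refine Finset.sum_congr rfl fun j _ => ?_
    ring

/-- Chain rule: one more state adds the entropy of the column of `P` at the last state, and that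
state has law `π` by stationarity. -/
lemma sum_negMulLog_pathWeight (hP : P ∈ Matrix.colStochastic ℝ (Fin k))
    (hπ : IsInvariantProbVector P π) (n : ℕ) :
    ∑ s, Real.negMulLog (pathWeight P π n s) =
      ∑ j, Real.negMulLog (π j) + n * entropyRate P π := by
  induction n with
  | zero =>
    rw [← (Equiv.funUnique (Fin 1) (Fin k)).symm.sum_comp]
    simp [pathWeight]
  | succ n ih =>
    rw [sum_snoc]
    have h1 : ∀ s : Fin (n + 1) → Fin k,
        ∑ i, Real.negMulLog (pathWeight P π (n + 1) (Fin.snoc s i : Fin (n + 2) → Fin k)) =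
        Real.negMulLog (pathWeight P π n s) +
          pathWeight P π n s * (fun j => ∑ i, Real.negMulLog (P i j)) (s (Fin.last n)) := by
      intro s
      simp only [pathWeight_snoc, Real.negMulLog_mul, Finset.sum_add_distrib, ← Finset.sum_mul,
        ← Finset.mul_sum, Matrix.sum_col_of_mem_colStochastic hP, one_mul]
    rw [Finset.sum_congr rfl fun s _ => h1 s, Finset.sum_add_distrib, ih,
      sum_pathWeight_mul_last hπ n fun j => ∑ i, Real.negMulLog (P i j)]
    have h2 : ∑ j, π j * ∑ i, Real.negMulLog (P i j) = entropyRate P π := by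
      simp only [entropyRate, Finset.mul_sum]
      rw [Finset.sum_comm, ← Finset.sum_neg_distrib]
      refine Finset.sum_congr rfl fun i _ => ?_
      rw [← Finset.sum_neg_distrib]
      refine Finset.sum_congr rfl fun j _ => ?_
      rw [Real.negMulLog]
      ring
    rw [h2]
    push_cast
    ring

lemma IsMarkovLaw.partitionEntropy_prefixMap (hP : P ∈ Matrix.colStochastic ℝ (Fin k))
    (hπ : IsInvariantProbVector P π) (hm : IsMarkovLaw P π m) (n : ℕ) :
    partitionEntropy m (fun ω (i : Fin (n + 1)) => ω i) =
      ∑ j, Real.negMulLog (π j) + n * entropyRate P π := by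
  rw [← sum_negMulLog_pathWeight hP hπ, partitionEntropy]
  refine Finset.sum_congr rfl fun s _ => ?_
  rw [Measure.real, ← Measure.map_apply (measurable_prefixMap _) (measurableSet_singleton _),
    hm.map_prefix_singleton, ENNReal.toReal_ofReal (pathWeight_nonneg hP.1 hπ.1.1 n s)]

lemma seqShift_iterate_apply {α : Type*} (ω : ℕ → α) (i j : ℕ) :
    (seqShift^[i] ω) j = ω (i + j) := by
  induction i generalizing ω with
  | zero => simp
  | succ i ih =>
    rw [Function.iterate_succ_apply, ih, seqShift]
    congr 1
    omega

/-- Every finite measurable partition is approximated by a partition into cylinders. -/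
lemma exists_prefix_approx [IsProbabilityMeasure m] {r : ℕ} [NeZero r]
    {ξ : (ℕ → Fin k) → Fin r} (hξ : Measurable ξ) {ε : ℝ} (hε : 0 < ε) :
    ∃ (N : ℕ) (g : (Fin N → Fin k) → Fin r), m.real {ω | ξ ω ≠ g fun i => ω i} ≤ ε := by
  classical
  have hr : 0 < (r : ℝ) := by exact_mod_cast NeZero.pos r
  have hex : ∀ a : Fin r, ∃ C ∈ measurableCylinders (fun _ : ℕ => Fin k),
      m (symmDiff C (ξ ⁻¹' {a})) < ENNReal.ofReal (ε / r) := fun a =>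
    exists_measure_symmDiff_lt_of_generateFrom_isSetRing isSetRing_measurableCylinders
      ⟨{Set.univ}, Set.countable_singleton _, by
        simpa using univ_mem_measurableCylinders (fun _ : ℕ => Fin k), by simp⟩
      generateFrom_measurableCylinders.symm (hξ (measurableSet_singleton a))
      (ENNReal.ofReal_pos.2 (by positivity))
  choose C hC hCm using hex
  have hdep : ∀ a, ∃ N, ∀ ω ω' : ℕ → Fin k, (∀ i < N, ω i = ω' i) → (ω ∈ C a ↔ ω' ∈ C a) := by
    intro a
    obtain ⟨s, S, -, hS⟩ := (mem_measurableCylinders _).1 (hC a)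
    refine ⟨s.sup id + 1, fun ω ω' h => ?_⟩
    rw [hS, mem_cylinder, mem_cylinder]
    have : s.restrict ω = s.restrict ω' := by
      ext i
      simp only [Finset.restrict_def]
      rw [h i (Nat.lt_succ_of_le (Finset.le_sup (f := id) i.2))]
    rw [this]
  choose N hN using hdep
  have hprob : Nonempty (ℕ → Fin k) := nonempty_of_isProbabilityMeasure m
  let ω₀ : ℕ → Fin k := Classical.arbitrary _
  let N' := Finset.univ.sup N
  -- No `C a` depends on the coordinates beyond `N'`, so any filler `ω₀` serves.
  let ext : (Fin N' → Fin k) → ℕ → Fin k := fun x i => if h : i < N' then x ⟨i, h⟩ else ω₀ i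
  let g : (Fin N' → Fin k) → Fin r := fun x =>
    if h : ∃ a, ext x ∈ C a then h.choose else 0
  refine ⟨N', g, ?_⟩
  -- Off the symmetric differences, `ω` lies in `C a` only for `a = ξ ω`, which forces the choice
  -- made by `g`; its default value matters only on the error set.
  have hsub : {ω | ξ ω ≠ g fun i => ω i} ⊆ ⋃ a, symmDiff (C a) (ξ ⁻¹' {a}) := by
    intro ω hω
    by_contra hnot
    refine hω ?_
    simp only [Set.mem_iUnion, not_exists] at hnot
    have hiff : ∀ a, ω ∈ C a ↔ ξ ω = a := by
      intro a
      have := hnot a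
      simp only [Set.mem_symmDiff, Set.mem_preimage, Set.mem_singleton_iff] at this
      tauto
    have hext : ∀ a, ext (fun i => ω i) ∈ C a ↔ ξ ω = a := by
      intro a
      rw [← hiff a]
      refine hN a _ _ fun i hi => ?_
      have : i < N' := hi.trans_le (Finset.le_sup (Finset.mem_univ a))
      simp [ext, this]
    have h : ∃ a, ext (fun i => ω i) ∈ C a := ⟨ξ ω, (hext _).2 rfl⟩
    have hg : g (fun i => ω i) = h.choose := dif_pos h
    rw [hg]
    exact (hext _).1 h.choose_spec
  have hle : m {ω | ξ ω ≠ g fun i => ω i} ≤ ENNReal.ofReal ε := by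
    calc _ ≤ m (⋃ a, symmDiff (C a) (ξ ⁻¹' {a})) := measure_mono hsub
      _ ≤ ∑ a, m (symmDiff (C a) (ξ ⁻¹' {a})) := measure_iUnion_fintype_le _ _
      _ ≤ ∑ _a : Fin r, ENNReal.ofReal (ε / r) := Finset.sum_le_sum fun a _ => (hCm a).le
      _ = ENNReal.ofReal ε := by
        rw [Finset.sum_const, Finset.card_univ, Fintype.card_fin, ← ENNReal.ofReal_nsmul,
          nsmul_eq_mul, mul_div_cancel₀ _ hr.ne']
  exact ENNReal.toReal_le_of_le_ofReal hε.le hle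

/-- The kernel which keeps a symbol with probability about `1 - δ` and otherwise resamples it. -/
noncomputable def noiseKernel (r : ℕ) (δ : ℝ) (b a : Fin r) : ℝ :=
  (if a = b then 1 - δ else 0) + δ / r

lemma noiseKernel_pos {r : ℕ} {δ : ℝ} (h0 : 0 < δ) (h1 : δ < 1) (b a : Fin r) :
    0 < noiseKernel r δ b a := by
  have hr : 0 < (r : ℝ) := by exact_mod_cast Fin.pos a
  have : 0 < δ / r := by positivity
  rw [noiseKernel]
  split_ifs <;> linarith

lemma sum_noiseKernel {r : ℕ} {δ : ℝ} (b : Fin r) : ∑ a, noiseKernel r δ b a = 1 := by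
  have hr : (r : ℝ) ≠ 0 := by exact_mod_cast (Fin.pos b).ne'
  simp only [noiseKernel, Finset.sum_add_distrib, Finset.sum_ite_eq', Finset.mem_univ, if_true,
    Finset.sum_const, Finset.card_univ, Fintype.card_fin, nsmul_eq_mul]
  field_simp
  ring

/-- A correct guess costs little. The resampling mass `δ / r` keeps the cost of a wrong one finite,
and wrong guesses will be rare. -/
lemma neg_log_noiseKernel_le {r : ℕ} {δ : ℝ} (h0 : 0 < δ) (h1 : δ < 1) (b a : Fin r) :
    -Real.log (noiseKernel r δ b a) ≤
      -Real.log (1 - δ) + (if a ≠ b then Real.log (r / δ) else 0) := by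
  have hr : 0 < (r : ℝ) := by exact_mod_cast Fin.pos a
  by_cases h : a = b
  · simp only [noiseKernel, h, if_true, ne_eq, not_true, if_false, add_zero, neg_le_neg_iff]
    exact Real.log_le_log (by linarith) (by have : 0 < δ / r := by positivity
                                            linarith)
  · simp only [noiseKernel, h, if_false, zero_add, ne_eq, not_false_iff, if_true]
    rw [← Real.log_inv, inv_div]
    have : Real.log (1 - δ) ≤ 0 := Real.log_nonpos (by linarith) (by linarith)
    linarith

/-- A prefix of `n + N + 1` states, hence `n + N` transitions, contains the `N`-windows from which
`g` guesses the `n` symbols. The product of noise kernels makes the losses add, and shift invariance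
makes them equal in mean. -/
lemma IsMarkovLaw.partitionEntropy_iterate_le (hP : P ∈ Matrix.colStochastic ℝ (Fin k))
    (hπ : IsInvariantProbVector P π) (hm : IsMarkovLaw P π m) {r : ℕ}
    {ξ : (ℕ → Fin k) → Fin r} (hξ : Measurable ξ) {N : ℕ} {g : (Fin N → Fin k) → Fin r}
    {ε δ : ℝ} (hg : m.real {ω | ξ ω ≠ g fun i => ω i} ≤ ε) (h0 : 0 < δ) (h1 : δ < 1) (n : ℕ) :
    partitionEntropy m (fun ω (i : Fin n) => ξ (seqShift^[i] ω)) ≤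
      ∑ j, Real.negMulLog (π j) + (n + N : ℕ) * entropyRate P π +
        n * (-Real.log (1 - δ) + ε * Real.log (r / δ)) := by
  have := hm.1
  have hshift := hm.measurePreserving_seqShift hP.1 hπ.1.1 hπ.2
  have hiter : ∀ i : ℕ, MeasurePreserving (seqShift^[i]) m m := fun i => hshift.iterate i
  have hA : Measurable fun (ω : ℕ → Fin k) (i : Fin n) => ξ (seqShift^[i] ω) :=
    measurable_pi_lambda _ fun i => hξ.comp (hiter i).measurable
  let win : Fin n → (Fin (n + N + 1) → Fin k) → Fin N → Fin k := fun i x j =>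
    x ⟨i + j, by omega⟩
  let R : (Fin (n + N + 1) → Fin k) → (Fin n → Fin r) → ℝ := fun x a =>
    ∏ i, noiseKernel r δ (g (win i x)) (a i)
  have hR : ∀ x a, 0 < R x a := fun x a => Finset.prod_pos fun i _ => noiseKernel_pos h0 h1 _ _
  have hR1 : ∀ x, ∑ a, R x a = 1 := by
    intro x
    rw [← Fintype.piFinset_univ,
      ← Finset.prod_univ_sum (fun _ : Fin n => (Finset.univ : Finset (Fin r)))
        (fun i a => noiseKernel r δ (g (win i x)) a)]
    simp only [sum_noiseKernel, Finset.prod_const_one]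
  have hmain := partitionEntropy_le_of_kernel (m := m) hA (measurable_prefixMap (n + N + 1)) hR hR1
  rw [hm.partitionEntropy_prefixMap hP hπ] at hmain
  refine hmain.trans ?_
  rw [sub_eq_add_neg, ← integral_neg]
  refine add_le_add le_rfl ?_
  let G : (ℕ → Fin k) → ℝ := fun ω => -Real.log (noiseKernel r δ (g fun i => ω i) (ξ ω))
  have hGmeas : Measurable G :=
    (Measurable.of_discrete (f := fun q : Fin r × Fin r =>
      -Real.log (noiseKernel r δ q.1 q.2))).comp
      (((Measurable.of_discrete (f := g)).comp (measurable_prefixMap N)).prodMk hξ)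
  have hGint : Integrable G m := by
    refine Integrable.of_bound hGmeas.aestronglyMeasurable
      (∑ a, ∑ b, |Real.log (noiseKernel r δ a b)|) (Eventually.of_forall fun ω => ?_)
    rw [Real.norm_eq_abs, abs_neg]
    exact (Finset.single_le_sum
      (f := fun b => |Real.log (noiseKernel r δ (g fun i => ω i) b)|)
      (fun b _ => abs_nonneg _) (Finset.mem_univ (ξ ω))).trans
      (Finset.single_le_sum (f := fun a => ∑ b, |Real.log (noiseKernel r δ a b)|)
      (fun a _ => Finset.sum_nonneg fun b _ => abs_nonneg _) (Finset.mem_univ (g fun i => ω i)))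
  have hGle : ∫ ω, G ω ∂m ≤ -Real.log (1 - δ) + ε * Real.log (r / δ) := by
    have hset : MeasurableSet {ω | ξ ω ≠ g fun i => ω i} :=
      (measurableSet_eq_fun hξ ((Measurable.of_discrete (f := g)).comp (measurable_prefixMap N))).compl
    have hlog : 0 ≤ Real.log (r / δ) := by
      obtain ⟨ω⟩ := nonempty_of_isProbabilityMeasure m
      have hr : (1 : ℝ) ≤ r := by exact_mod_cast Fin.pos (ξ ω)
      exact Real.log_nonneg ((one_le_div h0).2 (by linarith))
    calc ∫ ω, G ω ∂m ≤ ∫ ω, (-Real.log (1 - δ) +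
          {ω | ξ ω ≠ g fun i => ω i}.indicator (fun _ => Real.log (r / δ)) ω) ∂m := by
          refine integral_mono hGint ((integrable_const _).add
            ((integrable_const _).indicator hset)) fun ω => ?_
          have := neg_log_noiseKernel_le h0 h1 (g fun i => ω i) (ξ ω)
          simp only [Set.indicator_apply, Set.mem_ofPred_eq]
          exact this
      _ = -Real.log (1 - δ) + m.real {ω | ξ ω ≠ g fun i => ω i} * Real.log (r / δ) := by
          rw [integral_add (integrable_const _) ((integrable_const _).indicator hset),
            integral_indicator_const _ hset]
          simp
      _ ≤ _ := by
          have := mul_le_mul_of_nonneg_right hg hlog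
          linarith
  have hterm : ∀ ω : ℕ → Fin k,
      -Real.log (R (fun i => ω i) (fun i : Fin n => ξ (seqShift^[i] ω))) =
        ∑ i : Fin n, G (seqShift^[i] ω) := by
    intro ω
    simp only [R, G]
    rw [Real.log_prod fun i _ => (noiseKernel_pos h0 h1 _ _).ne', ← Finset.sum_neg_distrib]
    refine Finset.sum_congr rfl fun i _ => ?_
    have : win i (fun i => ω i) = fun j : Fin N => (seqShift^[i] ω) j := by
      ext j
      simp [win, seqShift_iterate_apply]
    rw [this]
  have hGi : ∀ i : ℕ, Integrable (fun ω => G (seqShift^[i] ω)) m := fun i =>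
    (hiter i).integrable_comp_of_integrable hGint
  have hGi2 : ∀ i : ℕ, ∫ ω, G (seqShift^[i] ω) ∂m = ∫ ω, G ω ∂m := by
    intro i
    conv_rhs => rw [← (hiter i).map_eq]
    rw [integral_map (hiter i).measurable.aemeasurable hGmeas.aestronglyMeasurable]
  simp only [hterm]
  rw [integral_finsetSum _ fun (i : Fin n) _ => hGi i]
  simp only [hGi2, Finset.sum_const, Finset.card_univ, Fintype.card_fin, nsmul_eq_mul]
  exact mul_le_mul_of_nonneg_left hGle (Nat.cast_nonneg n)

/-- The order of choice matters: `δ` first, then `ε` small against `log (r / δ)`. -/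
lemma exists_noise_lt {r : ℕ} [NeZero r] {η : ℝ} (hη : 0 < η) :
    ∃ δ ε : ℝ, 0 < δ ∧ δ < 1 ∧ 0 < ε ∧ -Real.log (1 - δ) + ε * Real.log (r / δ) ≤ η := by
  have hcont : Tendsto (fun δ : ℝ => -Real.log (1 - δ)) (𝓝[>] 0) (𝓝 0) := by
    have : ContinuousAt (fun δ : ℝ => -Real.log (1 - δ)) 0 := by
      refine ((continuousAt_const.sub continuousAt_id).log ?_).neg
      norm_num
    have h := this.tendsto
    simp only [sub_zero, Real.log_one, neg_zero] at h
    exact h.mono_left nhdsWithin_le_nhds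
  have h1 : ∀ᶠ δ : ℝ in 𝓝[>] 0, -Real.log (1 - δ) < η / 2 :=
    hcont.eventually (gt_mem_nhds (by positivity))
  have h2 : ∀ᶠ δ : ℝ in 𝓝[>] 0, δ ∈ Set.Ioo (0 : ℝ) 1 := Ioo_mem_nhdsGT one_pos
  obtain ⟨δ, hδ, h0, hlt⟩ := (h1.and h2).exists
  refine ⟨δ, η / 2 / (|Real.log (r / δ)| + 1), h0, hlt, by positivity, ?_⟩
  have hle : η / 2 / (|Real.log (r / δ)| + 1) * Real.log (r / δ) ≤ η / 2 := by
    rw [div_mul_eq_mul_div, div_le_iff₀ (by positivity)]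
    have := le_abs_self (Real.log (r / δ))
    exact mul_le_mul_of_nonneg_left (by linarith) (by positivity)
  linarith

lemma tendsto_affine_average (a b c : ℝ) (N : ℕ) :
    Tendsto (fun n : ℕ => 1 / (n : ℝ) * (a + (n + N : ℕ) * b + n * c)) atTop (𝓝 (b + c)) := by
  have h := (tendsto_one_div_atTop_nhds_zero_nat (𝕜 := ℝ)).mul_const (a + N * b)
  rw [zero_mul] at h
  have h' := h.add_const (b + c)
  rw [zero_add] at h'
  refine h'.congr' ?_
  filter_upwards [eventually_gt_atTop 0] with n hn
  have hn0 : (n : ℝ) ≠ 0 := by exact_mod_cast hn.ne'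
  push_cast
  field_simp
  ring

/-- The Kolmogorov–Sinai entropy of a stationary Markov shift is its entropy rate. -/
theorem IsMarkovLaw.kolmogorovEntropy_eq (hP : P ∈ Matrix.colStochastic ℝ (Fin k))
    (hπ : IsInvariantProbVector P π) (hm : IsMarkovLaw P π m) :
    kolmogorovEntropy seqShift m = (entropyRate P π : EReal) := by
  have := hm.1
  apply le_antisymm
  · refine iSup_le fun r => iSup_le fun ξ => iSup_le fun hξ => ?_
    have : NeZero r := by
      obtain ⟨ω⟩ := nonempty_of_isProbabilityMeasure m
      exact ⟨(Fin.pos (ξ ω)).ne'⟩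
    have hη : ∀ η : ℝ, 0 < η → limsup (fun n : ℕ => ((1 / (n : ℝ) *
        partitionEntropy m (fun x => fun i : Fin n => ξ (seqShift^[i] x)) : ℝ) : EReal)) atTop ≤
          ((entropyRate P π + η : ℝ) : EReal) := by
      intro η hη
      obtain ⟨δ, ε, h0, h1, hε, hle⟩ := exists_noise_lt (r := r) hη
      obtain ⟨N, g, hg⟩ := exists_prefix_approx (m := m) hξ hε
      have ht := tendsto_affine_average (∑ j, Real.negMulLog (π j)) (entropyRate P π) η N
      have ht' := (continuous_coe_real_ereal.tendsto _).comp ht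
      rw [← ht'.limsup_eq]
      refine limsup_le_limsup (Eventually.of_forall fun n => ?_)
      refine EReal.coe_le_coe_iff.2 (mul_le_mul_of_nonneg_left ?_ (by positivity))
      refine (hm.partitionEntropy_iterate_le hP hπ hξ hg h0 h1 n).trans ?_
      exact add_le_add le_rfl (mul_le_mul_of_nonneg_left hle (Nat.cast_nonneg n))
    have hlim : Tendsto (fun n : ℕ => ((entropyRate P π + 1 / ((n : ℝ) + 1) : ℝ) : EReal)) atTop
        (𝓝 (entropyRate P π : EReal)) := by
      have := (tendsto_one_div_add_atTop_nhds_zero_nat (𝕜 := ℝ)).const_add (entropyRate P π)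
      rw [add_zero] at this
      exact (continuous_coe_real_ereal.tendsto _).comp this
    exact ge_of_tendsto' hlim fun n => hη _ (by positivity)
  · have hmeas : Measurable fun ω : ℕ → Fin k => ω 0 := measurable_pi_apply 0
    refine le_iSup_of_le k (le_iSup_of_le (fun ω => ω 0) (le_iSup_of_le hmeas ?_))
    -- The joins of the first-symbol partition are the prefixes; `n` states have `n - 1`
    -- transitions, whence the subtracted rate.
    have ht := tendsto_affine_average (∑ j, Real.negMulLog (π j) - entropyRate P π)
      (entropyRate P π) 0 0
    have ht' := (continuous_coe_real_ereal.tendsto _).comp ht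
    rw [add_zero] at ht'
    refine le_of_eq ?_
    rw [← ht'.limsup_eq]
    refine limsup_congr ?_
    filter_upwards [eventually_gt_atTop 0] with n hn
    obtain ⟨n, rfl⟩ := Nat.exists_eq_succ_of_ne_zero hn.ne'
    have h1 : (fun (ω : ℕ → Fin k) (i : Fin (n + 1)) => (seqShift^[i] ω) 0) =
        fun ω i => ω i := by
      ext ω i
      simp [seqShift_iterate_apply]
    simp only [Function.comp_apply, Nat.succ_eq_add_one]
    rw [h1, hm.partitionEntropy_prefixMap hP hπ]
    congr 2
    push_cast
    ring

end MarkovEntropy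

/-! ### The trajectory law of the channel of a Markov chain -/

section TrajectoryLaw

variable {k : ℕ}

instance CMat.instMeasurableSingletonClass (k : ℕ) : MeasurableSingletonClass (CMat k) :=
  inferInstanceAs (MeasurableSingletonClass (Fin k → Fin k → ℂ))

/-- A finite power of a finite sum of Dirac masses. -/
lemma pi_sum_dirac {X ι : Type*} [MeasurableSpace X] [Fintype ι] (V : ι → X) (n : ℕ) :
    (Measure.pi fun _ : Fin n => ∑ e, Measure.dirac (V e)) =
      ∑ e : Fin n → ι, Measure.dirac fun i => V (e i) := by
  classical
  have : IsFiniteMeasure (∑ e, Measure.dirac (V e)) :=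
    ⟨by simp [Measure.finsetSum_apply, ENNReal.natCast_lt_top]⟩
  refine Measure.pi_eq (μ := fun _ : Fin n => ∑ e, Measure.dirac (V e)) fun s hs => ?_
  simp only [Measure.finsetSum_apply]
  rw [Finset.prod_univ_sum, Fintype.piFinset_univ]
  refine Finset.sum_congr rfl fun e _ => ?_
  rw [Measure.dirac_apply' _ (MeasurableSet.univ_pi hs)]
  simp only [Measure.dirac_apply' _ (hs _), Set.indicator_apply, Set.mem_pi, Set.mem_univ,
    true_imp_iff, Pi.one_apply]
  rw [Finset.prod_ite_zero]
  simp

/-- The matrix `V_ij = √p_ij |i⟩⟨j|` of the transition from `j` to `i`. -/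
noncomputable def transMat (P : Matrix (Fin k) (Fin k) ℝ) (i j : Fin k) : CMat k :=
  Matrix.single i j ((√(P i j) : ℝ) : ℂ)

/-- The sequence of transition matrices along a finite path. -/
noncomputable def pathMats (P : Matrix (Fin k) (Fin k) ℝ) (n : ℕ) (s : Fin (n + 1) → Fin k) :
    Fin n → CMat k :=
  fun i => transMat P (s i.succ) (s i.castSucc)

/-- The sequence of transition matrices along an infinite path. -/
noncomputable def trajMats (P : Matrix (Fin k) (Fin k) ℝ) (s : ℕ → Fin k) : ℕ → CMat k :=
  fun n => transMat P (s (n + 1)) (s n)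

variable {P : Matrix (Fin k) (Fin k) ℝ}

lemma measurable_trajMats : Measurable (trajMats P) :=
  measurable_pi_lambda _ fun n =>
    (Measurable.of_discrete (f := fun q : Fin k × Fin k => transMat P q.1 q.2)).comp
      (g := fun q : Fin k × Fin k => transMat P q.1 q.2)
      (f := fun s : ℕ → Fin k => (s (n + 1), s n))
      ((measurable_pi_apply (n + 1)).prodMk (measurable_pi_apply n))

lemma pathMats_snoc (n : ℕ) (s : Fin (n + 1) → Fin k) (i : Fin k) :
    pathMats P (n + 1) (Fin.snoc s i : Fin (n + 2) → Fin k) =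
      (Fin.snoc (pathMats P n s) (transMat P i (s (Fin.last n))) : Fin (n + 1) → CMat k) := by
  funext a
  induction a using Fin.lastCases with
  | last => simp only [pathMats, Fin.succ_last, Fin.snoc_last, Fin.snoc_castSucc]
  | cast a => simp only [pathMats, Fin.snoc_castSucc, Fin.succ_castSucc]

lemma matProd_snoc (L : CMat k → CMat k) (n : ℕ) (v : Fin n → CMat k) (M : CMat k) :
    matProd L (n + 1) (Fin.snoc v M : Fin (n + 1) → CMat k) = L M * matProd L n v := by
  simp only [matProd, Fin.snoc_last, Fin.snoc_castSucc]

lemma markovChannelMeasure_eq :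
    markovChannelMeasure P =
      ∑ e : Fin k × Fin k, Measure.dirac (transMat P e.1 e.2) := by
  rw [markovChannelMeasure, Fintype.sum_prod_type]
  rfl

lemma setLIntegral_pi_markovChannelMeasure (n : ℕ) {A : Set (Fin n → CMat k)}
    (hA : MeasurableSet A) (F : (Fin n → CMat k) → ℝ≥0∞) :
    ∫⁻ v in A, F v ∂(Measure.pi fun _ => markovChannelMeasure P) =
      ∑ e : Fin n → Fin k × Fin k, A.indicator F fun i => transMat P (e i).1 (e i).2 := by
  rw [← lintegral_indicator hA, markovChannelMeasure_eq, pi_sum_dirac,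
    lintegral_finsetSum_measure]
  simp only [lintegral_dirac]

/-- The squared modulus of a coordinate of `W x`. -/
noncomputable def coordSq (x : EuclideanSpace ℂ (Fin k)) (W : CMat k) (b : Fin k) : ℝ≥0∞ :=
  ENNReal.ofReal (‖(Matrix.toEuclideanCLM (𝕜 := ℂ) W x) b‖ ^ 2)

lemma coordSq_one (x : EuclideanSpace ℂ (Fin k)) (b : Fin k) :
    coordSq x 1 b = ENNReal.ofReal (‖x b‖ ^ 2) := by
  simp [coordSq]

lemma coordSq_transMat_mul (hP : ∀ i j, 0 ≤ P i j) (x : EuclideanSpace ℂ (Fin k)) (W : CMat k)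
    (i j b : Fin k) :
    coordSq x (transMat P i j * W) b =
      if i = b then ENNReal.ofReal (P i j) * coordSq x W j else 0 := by
  rw [coordSq, coordSq, map_mul, mul_apply_eq_comp]
  set y := Matrix.toEuclideanCLM (𝕜 := ℂ) W x
  have h : (Matrix.toEuclideanCLM (𝕜 := ℂ) (transMat P i j) y) b =
      if i = b then ((√(P i j) : ℝ) : ℂ) * y j else 0 := by
    change (transMat P i j).mulVec y.ofLp b = _
    rw [transMat, Matrix.single_mulVec]
    by_cases hib : i = b
    · simp [hib]
    · simp [hib, Function.update_of_ne (Ne.symm hib)]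
  rw [h]
  split_ifs with hib
  · rw [norm_mul, mul_pow, ← ENNReal.ofReal_mul (hP i j), Complex.norm_real, Real.norm_eq_abs,
      sq_abs, Real.sq_sqrt (hP i j)]
  · simp

/-- Tuples of transitions that do not chain up contribute zero, so the sum over tuples collapses to
paths. The endpoint `b` and the test function `f` stay free because the induction must match the
previous endpoint with the source of the new transition and absorb that transition into `f`. -/
lemma sum_coordSq (hP : ∀ i j, 0 ≤ P i j) (x : EuclideanSpace ℂ (Fin k)) (n : ℕ)
    (f : (Fin n → CMat k) → ℝ≥0∞) (b : Fin k) :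
    ∑ e : Fin n → Fin k × Fin k, f (fun i => transMat P (e i).1 (e i).2) *
        coordSq x (matProd id n fun i => transMat P (e i).1 (e i).2) b =
      ∑ s : Fin (n + 1) → Fin k, if s (Fin.last n) = b then
        f (pathMats P n s) * ENNReal.ofReal (pathWeight P (fun j => ‖x j‖ ^ 2) n s) else 0 := by
  induction n generalizing b with
  | zero =>
    rw [← (Equiv.funUnique (Fin 1) (Fin k)).symm.sum_comp]
    simp only [Finset.univ_unique, Finset.sum_singleton, matProd, coordSq_one]
    rw [Finset.sum_eq_single b]
    · simp [pathWeight, Subsingleton.elim (pathMats P 0 _) default,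
        Subsingleton.elim (fun i : Fin 0 => transMat P _ _) default]
    · intro j _ hj
      simp [hj]
    · simp
  | succ n ih =>
    have hsnoc : ∀ (e : Fin n → Fin k × Fin k) (q : Fin k × Fin k),
        (fun i => transMat P ((Fin.snoc e q : Fin (n + 1) → Fin k × Fin k) i).1
          ((Fin.snoc e q : Fin (n + 1) → Fin k × Fin k) i).2) =
        (Fin.snoc (fun i => transMat P (e i).1 (e i).2) (transMat P q.1 q.2) :
          Fin (n + 1) → CMat k) := by
      intro e q
      funext a
      induction a using Fin.lastCases with
      | last => simp only [Fin.snoc_last]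
      | cast a => simp only [Fin.snoc_castSucc]
    rw [sum_snoc, sum_snoc]
    simp only [hsnoc, matProd_snoc, id_eq, coordSq_transMat_mul hP, Fintype.sum_prod_type,
      pathMats_snoc, pathWeight_snoc, Fin.snoc_last, mul_ite, mul_zero]
    simp only [Finset.sum_ite_irrel, Finset.sum_const_zero, Finset.sum_ite_eq', Finset.mem_univ,
      if_true]
    rw [Finset.sum_comm]
    have h1 : ∀ j, ∑ e : Fin n → Fin k × Fin k,
        f (Fin.snoc (fun i => transMat P (e i).1 (e i).2) (transMat P b j) :
          Fin (n + 1) → CMat k) * (ENNReal.ofReal (P b j) *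
            coordSq x (matProd id n fun i => transMat P (e i).1 (e i).2) j) =
        ∑ s : Fin (n + 1) → Fin k, if s (Fin.last n) = j then
          f (Fin.snoc (pathMats P n s) (transMat P b j) : Fin (n + 1) → CMat k) *
            ENNReal.ofReal (P b j) *
            ENNReal.ofReal (pathWeight P (fun j => ‖x j‖ ^ 2) n s) else 0 := by
      intro j
      rw [← ih (fun v => f (Fin.snoc v (transMat P b j) : Fin (n + 1) → CMat k) *
            ENNReal.ofReal (P b j)) j]
      simp only [mul_assoc]
    rw [Finset.sum_congr rfl fun j _ => h1 j, Finset.sum_comm]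
    refine Finset.sum_congr rfl fun s _ => ?_
    rw [Finset.sum_ite_eq, if_pos (Finset.mem_univ _),
      ENNReal.ofReal_mul (pathWeight_nonneg hP (fun _ => by positivity) _ _), mul_assoc,
      mul_comm (ENNReal.ofReal (P b _))]

/-- A unit representative of a point of projective space. -/
noncomputable def unitRep (x : CProj k) : EuclideanSpace ℂ (Fin k) :=
  ((‖x.rep‖⁻¹ : ℝ) : ℂ) • x.rep

lemma norm_unitRep (x : CProj k) : ‖unitRep x‖ = 1 := by
  rw [unitRep, norm_smul, Complex.norm_real, norm_inv, norm_norm,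
    inv_mul_cancel₀ (norm_ne_zero_iff.2 x.rep_nonzero)]

lemma normSqOn_eq_sum_coordSq (A : CMat k) (x : CProj k) :
    normSqOn A x = ∑ b, coordSq (unitRep x) A b := by
  simp only [coordSq]
  rw [normSqOn, ← ENNReal.ofReal_sum_of_nonneg fun _ _ => by positivity,
    ← EuclideanSpace.norm_sq_eq, unitRep, map_smul, norm_smul, Complex.norm_real, norm_inv,
    norm_norm, inv_mul_eq_div]

/-- The probability `|x_j|²` of observing `j` in the state of unit representative `x`. -/
noncomputable def bornWeight (x : CProj k) (j : Fin k) : ℝ := ‖unitRep x j‖ ^ 2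

lemma sum_bornWeight (x : CProj k) : ∑ j, bornWeight x j = 1 := by
  simp only [bornWeight]
  rw [← EuclideanSpace.norm_sq_eq, norm_unitRep, one_pow]

instance CProj.instBorelSpace (k : ℕ) : BorelSpace (CProj k) := ⟨rfl⟩

/-- The chosen representative need not vary measurably, but `(‖v j‖ / ‖v‖) ^ 2` is scale-invariant
and continuous, so it descends to the quotient. -/
lemma measurable_bornWeight (j : Fin k) : Measurable fun x : CProj k => bornWeight x j := by
  refine Continuous.measurable (continuous_coinduced_dom.2 ?_)
  have h : (fun x : CProj k => bornWeight x j) ∘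
      (fun v : {v : EuclideanSpace ℂ (Fin k) // v ≠ 0} => Projectivization.mk' ℂ v) =
      fun v : {v : EuclideanSpace ℂ (Fin k) // v ≠ 0} =>
        (‖(v : EuclideanSpace ℂ (Fin k)) j‖ / ‖(v : EuclideanSpace ℂ (Fin k))‖) ^ 2 := by
    funext v
    obtain ⟨a, ha⟩ := Projectivization.exists_smul_eq_mk_rep ℂ v.1 v.2
    have ha0 : ‖(a : ℂ)‖ ≠ 0 := norm_ne_zero_iff.2 a.ne_zero
    have hv0 : ‖(v : EuclideanSpace ℂ (Fin k))‖ ≠ 0 := norm_ne_zero_iff.2 v.2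
    simp only [Function.comp_apply, Projectivization.mk'_eq_mk, bornWeight, unitRep, ← ha,
      PiLp.smul_apply, norm_smul, Complex.norm_real, norm_inv, norm_norm, Units.smul_def,
      smul_eq_mul, norm_mul]
    field_simp
  rw [h]
  refine Continuous.pow (Continuous.div ?_ ?_ fun v => norm_ne_zero_iff.2 v.2) 2
  · fun_prop
  · fun_prop

lemma pathWeight_eq_sum_single (l : Fin k → ℝ) (n : ℕ) (s : Fin (n + 1) → Fin k) :
    pathWeight P l n s = ∑ j, l j * pathWeight P (Pi.single j 1) n s := by
  rw [Finset.sum_eq_single (s 0)]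
  · simp [pathWeight]
  · intro j _ hj
    simp [pathWeight, hj.symm]
  · simp

/-- Path weights are linear in the initial vector, so sorting by the starting state separates `x`
from the matrices; each `j` then yields a product measure. -/
lemma setLIntegral_normSqOn (hP : ∀ i j, 0 ≤ P i j) (n : ℕ) {A : Set (Fin n → CMat k)}
    (hA : MeasurableSet A) (x : CProj k) :
    ∫⁻ v in A, normSqOn (matProd id n v) x ∂(Measure.pi fun _ => markovChannelMeasure P) =
      ∑ j, ENNReal.ofReal (bornWeight x j) *
        ∑ s, (pathMats P n ⁻¹' A).indicator
          (fun s => ENNReal.ofReal (pathWeight P (Pi.single j 1) n s)) s := by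
  classical
  rw [setLIntegral_pi_markovChannelMeasure n hA]
  have h1 : ∀ v, A.indicator (fun v => normSqOn (matProd id n v) x) v =
      ∑ b, A.indicator 1 v * coordSq (unitRep x) (matProd id n v) b := by
    intro v
    rw [← Finset.mul_sum, ← normSqOn_eq_sum_coordSq]
    by_cases hv : v ∈ A <;> simp [hv]
  simp only [h1]
  rw [Finset.sum_comm]
  simp only [sum_coordSq hP (unitRep x) n (A.indicator 1)]
  rw [Finset.sum_comm]
  simp only [Finset.sum_ite_eq, Finset.mem_univ, if_true, Finset.mul_sum]
  rw [Finset.sum_comm]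
  refine Finset.sum_congr rfl fun s _ => ?_
  have hb : ∀ j, 0 ≤ bornWeight x j := fun j => by rw [bornWeight]; positivity
  have hs : ∀ j, 0 ≤ pathWeight P (Pi.single j 1) n s := fun j =>
    pathWeight_nonneg hP (fun i => by rw [Pi.single_apply]; split_ifs <;> norm_num) _ _
  change A.indicator 1 (pathMats P n s) * ENNReal.ofReal (pathWeight P (bornWeight x) n s) = _
  rw [pathWeight_eq_sum_single, ENNReal.ofReal_sum_of_nonneg fun j _ => mul_nonneg (hb j) (hs j)]
  simp only [ENNReal.ofReal_mul (hb _)]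
  by_cases hv : pathMats P n s ∈ A <;> simp [hv]

lemma IsTrajectoryLaw.unique {μ : Measure (CMat k)} {L : CMat k → CMat k}
    {ν : Measure (CProj k)} {Q Q' : Measure (CProj k × (ℕ → CMat k))}
    (hQ : IsTrajectoryLaw μ L ν Q) (hQ' : IsTrajectoryLaw μ L ν Q') : Q = Q' := by
  have := hQ.1
  have := hQ'.1
  refine Measure.ext_prod fun {S} {T} hS hT => ?_
  -- With `S` fixed, both sides are finite measures on sequences, determined by their prefixes.
  have key : (Q.restrict (S ×ˢ Set.univ)).map Prod.snd =
      (Q'.restrict (S ×ˢ Set.univ)).map Prod.snd := by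
    refine measure_ext_of_prefixes fun n A hA => ?_
    have hpre : MeasurableSet {ω : ℕ → CMat k | (fun i : Fin n => ω i) ∈ A} :=
      measurable_prefixMap n hA
    have hset : Prod.snd ⁻¹' {ω : ℕ → CMat k | (fun i : Fin n => ω i) ∈ A} ∩ S ×ˢ Set.univ =
        S ×ˢ {ω : ℕ → CMat k | (fun i : Fin n => ω i) ∈ A} := by
      ext ⟨x, ω⟩
      simp [and_comm]
    rw [Measure.map_apply measurable_snd hpre, Measure.map_apply measurable_snd hpre,
      Measure.restrict_apply (measurable_snd hpre), Measure.restrict_apply (measurable_snd hpre),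
      hset, hQ.2 n S A hS hA, hQ'.2 n S A hS hA]
  have h := congrArg (fun m => m T) key
  simp only [Measure.map_apply measurable_snd hT,
    Measure.restrict_apply (measurable_snd hT)] at h
  have hset : Prod.snd ⁻¹' T ∩ S ×ˢ Set.univ = S ×ˢ T := by
    ext ⟨x, ω⟩
    simp [and_comm]
  rwa [hset] at h

/-- The trajectory law is a mixture of the laws of the chains started at a point. -/
theorem isTrajectoryLaw_mixture (hP : ∀ i j, 0 ≤ P i j) {m : Fin k → Measure (ℕ → Fin k)}
    (hm : ∀ j, IsMarkovLaw P (Pi.single j 1) (m j)) (ν : Measure (CProj k))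
    [IsProbabilityMeasure ν] :
    IsTrajectoryLaw (markovChannelMeasure P) id ν
      (∑ j, (ν.withDensity fun x => ENNReal.ofReal (bornWeight x j)).prod
        ((m j).map (trajMats P))) := by
  have := fun j => (hm j).1
  have := fun j => Measure.isProbabilityMeasure_map (μ := m j)
    (measurable_trajMats (P := P)).aemeasurable
  have hmeas : ∀ j : Fin k, Measurable fun x : CProj k => ENNReal.ofReal (bornWeight x j) :=
    fun j => (measurable_bornWeight j).ennreal_ofReal
  refine ⟨⟨?_⟩, fun n S A hS hA => ?_⟩
  · rw [Measure.finsetSum_apply]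
    simp only [← Set.univ_prod_univ, Measure.prod_prod, measure_univ, mul_one]
    simp only [withDensity_apply _ MeasurableSet.univ, Measure.restrict_univ]
    rw [← lintegral_finsetSum _ fun j _ => hmeas j]
    have hone : ∀ x : CProj k, ∑ j, ENNReal.ofReal (bornWeight x j) = 1 := by
      intro x
      rw [← ENNReal.ofReal_sum_of_nonneg fun j _ => by rw [bornWeight]; positivity,
        sum_bornWeight, ENNReal.ofReal_one]
    simp [hone]
  · simp only [setLIntegral_normSqOn hP n hA]
    rw [Measure.finsetSum_apply, lintegral_finsetSum _ fun j _ => (hmeas j).mul_const _]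
    refine Finset.sum_congr rfl fun j _ => ?_
    have hpre : MeasurableSet {ω : ℕ → CMat k | (fun i : Fin n => ω i) ∈ A} :=
      measurable_prefixMap n hA
    rw [lintegral_mul_const _ (hmeas j), Measure.prod_prod, withDensity_apply _ hS,
      Measure.map_apply measurable_trajMats hpre, ← (hm j).measure_prefix_mem]
    rfl

end TrajectoryLaw

/-! ### Norms of exterior powers -/

section WedgeNorm

variable {k : ℕ}

/-- The matrix of the first exterior power, as a linear isomorphism onto operators. -/
noncomputable def wedgeOneEquiv (k : ℕ) :
    CMat k ≃ₗ[ℂ] (EuclideanSpace ℂ (Set.powersetCard (Fin k) 1) →L[ℂ]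
      EuclideanSpace ℂ (Set.powersetCard (Fin k) 1)) :=
  Matrix.toLin'.trans (((exteriorPower.oneEquiv ℂ (Fin k → ℂ)).symm.conj).trans
    ((LinearMap.toMatrix ((Pi.basisFun ℂ (Fin k)).exteriorPower 1)
      ((Pi.basisFun ℂ (Fin k)).exteriorPower 1)).trans
      (Matrix.toEuclideanCLM (𝕜 := ℂ)
        (n := Set.powersetCard (Fin k) 1)).toAlgEquiv.toLinearEquiv))

/-- A norm pulled back along a linear isomorphism is homogeneous, continuous and nonzero off zero,
which is all that the growth rate needs. -/
lemma wedgeNorm_one (A : CMat k) : wedgeNorm 1 A = ‖wedgeOneEquiv k A‖ := by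
  have h : exteriorPower.map 1 (Matrix.toLin' A) =
      (exteriorPower.oneEquiv ℂ (Fin k → ℂ)).symm.conj (Matrix.toLin' A) := by
    have h1 := exteriorPower.oneEquiv_naturality (Matrix.toLin' A)
    refine LinearMap.ext fun x => ?_
    simp only [LinearEquiv.conj_apply, LinearMap.comp_apply, LinearEquiv.coe_coe,
      LinearEquiv.symm_symm]
    apply (exteriorPower.oneEquiv ℂ (Fin k → ℂ)).injective
    rw [LinearEquiv.apply_symm_apply]
    exact LinearMap.congr_fun h1 x
  rw [wedgeNorm, h]
  rfl

lemma wedgeNorm_mul_of_exteriorPower_map_eq_zero {p : ℕ} {A : CMat k} (B : CMat k)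
    (h : exteriorPower.map p (Matrix.toLin' A) = 0) : wedgeNorm p (A * B) = 0 := by
  rw [wedgeNorm, Matrix.toLin'_mul, exteriorPower.map_comp, h, LinearMap.zero_comp, map_zero,
    map_zero, norm_zero]

/-- The image is a line, and a wedge of two or more collinear vectors vanishes. -/
lemma exteriorPower_map_single {p : ℕ} (hp : 2 ≤ p) (i j : Fin k) (c : ℂ) :
    exteriorPower.map p (Matrix.toLin' (Matrix.single i j c)) = 0 := by
  refine exteriorPower.linearMap_ext ?_
  ext v
  simp only [LinearMap.compAlternatingMap_apply, exteriorPower.map_apply_ιMulti,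
    LinearMap.zero_apply]
  have h : (Matrix.toLin' (Matrix.single i j c)) ∘ v =
      fun a => (c * v a j) • (Pi.single i 1 : Fin k → ℂ) := by
    funext a b
    simp only [Function.comp_apply, Matrix.toLin'_apply, Matrix.single_mulVec, Pi.smul_apply,
      smul_eq_mul, Pi.single_apply, Function.update_apply, mul_ite, mul_one, mul_zero, Pi.zero_apply]
  rw [h]
  have h2 := (exteriorPower.ιMulti ℂ p (M := Fin k → ℂ)).toMultilinearMap.map_smul_univ
    (fun a => c * v a j) (fun _ => (Pi.single i 1 : Fin k → ℂ))
  simp only [AlternatingMap.coe_multilinearMap] at h2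
  have h01 : (⟨0, by omega⟩ : Fin p) ≠ ⟨1, by omega⟩ := by simp
  rw [h2, AlternatingMap.map_eq_zero_of_eq _ (fun _ => (Pi.single i 1 : Fin k → ℂ))
    rfl h01, smul_zero]

end WedgeNorm

/-! ### Lyapunov exponents of the channel of a Markov chain -/

section Lyapunov

variable {k : ℕ} {P : Matrix (Fin k) (Fin k) ℝ} {l : Fin k → ℝ} {m : Measure (ℕ → Fin k)}

instance CMat.instBorelSpace (k : ℕ) : BorelSpace (CMat k) :=
  inferInstanceAs (BorelSpace (Fin k → Fin k → ℂ))

lemma measurable_matProd_prefixMap (n : ℕ) :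
    Measurable fun ω : ℕ → CMat k => matProd id n fun i : Fin n => ω i := by
  induction n with
  | zero => exact measurable_const
  | succ n ih =>
    have h1 : Measurable fun ω : ℕ → CMat k => ω n := measurable_pi_apply n
    refine measurable_pi_lambda _ fun a => measurable_pi_lambda _ fun b => ?_
    change Measurable fun ω : ℕ → CMat k =>
      (ω n * matProd id n fun i : Fin n => ω i) a b
    simp only [Matrix.mul_apply]
    refine Finset.measurable_sum _ fun c _ => Measurable.mul ?_ ?_
    · exact (measurable_pi_apply c).comp ((measurable_pi_apply a).comp h1)
    · exact (measurable_pi_apply b).comp ((measurable_pi_apply c).comp ih)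

lemma measurable_norm_wedgeOneEquiv :
    Measurable fun A : CMat k => ‖wedgeOneEquiv k A‖ :=
  ((wedgeOneEquiv k).toLinearMap.continuous_of_finiteDimensional.norm).measurable

lemma matProd_trajMats (s : ℕ → Fin k) (n : ℕ) :
    (matProd id (n + 1) fun i : Fin (n + 1) => trajMats P s i) =
      Matrix.single (s (n + 1)) (s 0)
        ((∏ i ∈ Finset.range (n + 1), √(P (s (i + 1)) (s i)) : ℝ) : ℂ) := by
  induction n with
  | zero => simp [matProd, trajMats, transMat]
  | succ n ih =>
    have h : (matProd id (n + 2) fun i : Fin (n + 2) => trajMats P s i) =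
        trajMats P s (n + 1) * matProd id (n + 1) fun i : Fin (n + 1) => trajMats P s i := rfl
    rw [h, ih, trajMats, transMat, Matrix.single_mul_single_same, Finset.prod_range_succ _ (n + 1),
      mul_comm]
    push_cast
    rfl

/-- A path with a forbidden transition has weight zero. This excludes zero factors, so that the
logarithm of the product splits into a sum. -/
lemma IsMarkovLaw.ae_transition_pos (hP : ∀ i j, 0 ≤ P i j) (hm : IsMarkovLaw P l m) :
    ∀ᵐ s ∂m, ∀ n : ℕ, 0 < P (s (n + 1)) (s n) := by
  refine ae_all_iff.2 fun n => ?_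
  have h := hm.measure_prefix_mem (n + 1) {t | P (t (Fin.last (n + 1))) (t (Fin.last n).castSucc) = 0}
  rw [Finset.sum_eq_zero] at h
  · filter_upwards [measure_eq_zero_iff_ae_notMem.1 h] with s hs
    exact lt_of_le_of_ne (hP _ _) (Ne.symm hs)
  · intro t _
    by_cases ht : t ∈ {t : Fin (n + 2) → Fin k |
        P (t (Fin.last (n + 1))) (t (Fin.last n).castSucc) = 0}
    · rw [Set.indicator_of_mem ht, pathWeight, Fin.prod_univ_castSucc, Fin.succ_last,
        show P (t (Fin.last (n + 1))) (t (Fin.last n).castSucc) = 0 from ht]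
      simp
    · rw [Set.indicator_of_notMem ht]

/-- The growth rate of `W_n` along almost every path of the chain. -/
lemma IsMarkovLaw.ae_tendsto_log_norm [NeZero k] (hP : P ∈ Matrix.colStochastic ℝ (Fin k))
    (hirr : P.IsIrreducible) {π : Fin k → ℝ} (hπ : IsInvariantProbVector P π)
    (hl : l ∈ stdSimplex ℝ (Fin k)) (hm : IsMarkovLaw P l m) :
    ∀ᵐ s ∂m, (∀ n : ℕ, ‖wedgeOneEquiv k (matProd id (n + 1) fun i => trajMats P s i)‖ ≠ 0) ∧
      Tendsto (fun n : ℕ => 1 / (n : ℝ) *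
        Real.log ‖wedgeOneEquiv k (matProd id n fun i => trajMats P s i)‖) atTop
        (𝓝 (1 / 2 * ∑ i, ∑ j, π j * P i j * Real.log (P i j))) := by
  filter_upwards [hm.ae_transition_pos hP.1,
    hm.ae_tendsto_average hP hirr hπ hl fun i j => Real.log (P i j)] with s hpos hlim
  have hsingle : ∀ a b : Fin k, ‖wedgeOneEquiv k (Matrix.single a b 1)‖ ≠ 0 := by
    intro a b
    rw [norm_ne_zero_iff, (wedgeOneEquiv k).map_ne_zero_iff]
    intro h
    have := congrFun (congrFun h a) b
    simp at this
  have hsqrt : ∀ i, 0 < √(P (s (i + 1)) (s i)) := fun i => Real.sqrt_pos.2 (hpos i)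
  have hprod : ∀ n, 0 < ∏ i ∈ Finset.range n, √(P (s (i + 1)) (s i)) := fun n =>
    Finset.prod_pos fun i _ => hsqrt i
  have hnorm : ∀ n, ‖wedgeOneEquiv k (matProd id (n + 1) fun i => trajMats P s i)‖ =
      (∏ i ∈ Finset.range (n + 1), √(P (s (i + 1)) (s i))) *
        ‖wedgeOneEquiv k (Matrix.single (s (n + 1)) (s 0) 1)‖ := by
    intro n
    have h : ∀ c : ℝ, (Matrix.single (s (n + 1)) (s 0) (c : ℂ) : CMat k) =
        (c : ℂ) • Matrix.single (s (n + 1)) (s 0) 1 := fun c => by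
      rw [Matrix.smul_single, smul_eq_mul, mul_one]
    rw [matProd_trajMats, h, map_smul, norm_smul, Complex.norm_real, Real.norm_eq_abs,
      abs_of_pos (hprod _)]
  refine ⟨fun n => ?_, ?_⟩
  · rw [hnorm]
    exact mul_ne_zero (hprod _).ne' (hsingle _ _)
  -- The norms of matrix units take finitely many nonzero values, so their logarithms are bounded.
  · have hbdd : Tendsto (fun n : ℕ => (1 / (n : ℝ)) *
        Real.log ‖wedgeOneEquiv k (Matrix.single (s n) (s 0) 1)‖) atTop (𝓝 0) := by
      refine tendsto_one_div_atTop_nhds_zero_nat.zero_mul_isBoundedUnder_le ?_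
      refine isBoundedUnder_of
        ⟨∑ a, |Real.log ‖wedgeOneEquiv k (Matrix.single a (s 0) 1)‖|, fun n => ?_⟩
      simp only [Function.comp_apply, Real.norm_eq_abs]
      exact Finset.single_le_sum
        (f := fun a => |Real.log ‖wedgeOneEquiv k (Matrix.single a (s 0) 1)‖|)
        (fun a _ => abs_nonneg _) (Finset.mem_univ _)
    have h := (hlim.const_mul (1 / 2)).add hbdd
    rw [add_zero] at h
    refine h.congr' ?_
    filter_upwards [eventually_gt_atTop 0] with n hn
    obtain ⟨n, rfl⟩ := Nat.exists_eq_succ_of_ne_zero hn.ne'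
    rw [Nat.succ_eq_add_one, hnorm, Real.log_mul (hprod _).ne' (hsingle _ _),
      Real.log_prod fun i _ => (hsqrt i).ne']
    simp only [Real.log_sqrt (hP.1 _ _), ← Finset.sum_div]
    ring

lemma ae_mixture_of_ae {m : Fin k → Measure (ℕ → Fin k)} (ν : Measure (CProj k))
    {p : (ℕ → CMat k) → Prop} (hp : MeasurableSet {ω | p ω})
    (h : ∀ j, ∀ᵐ s ∂(m j), p (trajMats P s)) :
    ∀ᵐ z ∂(∑ j, (ν.withDensity fun x => ENNReal.ofReal (bornWeight x j)).prod
        ((m j).map (trajMats P))), p z.2 := by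
  rw [ae_iff, Measure.finsetSum_apply]
  refine Finset.sum_eq_zero fun j _ => ?_
  rw [← ae_iff]
  exact Measure.quasiMeasurePreserving_snd.ae
    ((ae_map_iff measurable_trajMats.aemeasurable hp).2 (h j))

lemma tendsto_ereal_log {u : ℕ → ℝ} {c : ℝ} (hu0 : ∀ n, 0 ≤ u n) (hu : ∀ n, u (n + 1) ≠ 0)
    (h : Tendsto (fun n : ℕ => 1 / (n : ℝ) * Real.log (u n)) atTop (𝓝 c)) :
    Tendsto (fun n : ℕ => ((1 / (n : ℝ) : ℝ) : EReal) * ENNReal.log (ENNReal.ofReal (u n))) atTop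
      (𝓝 (c : EReal)) := by
  have h' := (continuous_coe_real_ereal.tendsto _).comp h
  refine h'.congr' ?_
  filter_upwards [eventually_gt_atTop 0] with n hn
  obtain ⟨n, rfl⟩ := Nat.exists_eq_succ_of_ne_zero hn.ne'
  rw [ENNReal.log_ofReal_of_pos (lt_of_le_of_ne (hu0 _) (hu n).symm)]
  simp only [Function.comp_apply, EReal.coe_mul]

/-- The exponents of a chain whose first exponent is `c` and whose other ones are `-∞`. -/
noncomputable def rankOneSpectrum (k : ℕ) (c : ℝ) (j : Fin k) : EReal :=
  if j.val = 0 then (c : EReal) else ⊥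

lemma sum_filter_val_lt_one [NeZero k] (γ : Fin k → EReal) :
    ∑ j : Fin k with j.val < 1, γ j = γ 0 := by
  have : (Finset.univ.filter fun j : Fin k => j.val < 1) = {0} := by
    ext j
    simp only [Finset.mem_filter, Finset.mem_univ, true_and, Finset.mem_singleton, Nat.lt_one_iff,
      Fin.ext_iff, Fin.val_zero]
  rw [this, Finset.sum_singleton]

lemma sum_eq_bot_of_eq_bot {ι : Type*} {S : Finset ι} {γ : ι → EReal} {j : ι} (hj : j ∈ S)
    (h : γ j = ⊥) : ∑ i ∈ S, γ i = ⊥ := by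
  classical
  rw [← Finset.add_sum_erase S γ hj, h, EReal.bot_add]

theorem isLyapunovSpectrum_rankOneSpectrum [NeZero k]
    (hP : P ∈ Matrix.colStochastic ℝ (Fin k)) (hirr : P.IsIrreducible) {π : Fin k → ℝ}
    (hπ : IsInvariantProbVector P π) :
    IsLyapunovSpectrum (markovChannelMeasure P) id
      (rankOneSpectrum k (1 / 2 * ∑ i, ∑ j, π j * P i j * Real.log (P i j))) := by
  set c := 1 / 2 * ∑ i, ∑ j, π j * P i j * Real.log (P i j) with hc
  refine ⟨fun i j hij => ?_, fun j => ?_, fun ν hν Q hQ p hp1 hpk => ?_⟩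
  · simp only [rankOneSpectrum]
    split_ifs with h1 h2
    · exact le_rfl
    · exact absurd (Nat.le_zero.1 (h1 ▸ hij)) h2
    · exact bot_le
    · exact le_rfl
  · simp only [rankOneSpectrum]
    split_ifs
    · exact EReal.coe_lt_top _
    · exact bot_lt_top
  choose m hm using fun j : Fin k => exists_isMarkovLaw hP (single_mem_stdSimplex ℝ j)
  have hmix := isTrajectoryLaw_mixture hP.1 hm ν
  rw [hQ.unique hmix]
  rcases Nat.lt_or_ge p 2 with hp | hp
  · obtain rfl : p = 1 := by omega
    rw [sum_filter_val_lt_one]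
    simp only [wedgeNorm_one]
    have hmeas : ∀ n, Measurable fun ω : ℕ → CMat k =>
        ‖wedgeOneEquiv k (matProd id n fun i : Fin n => ω i)‖ := fun n =>
      measurable_norm_wedgeOneEquiv.comp (measurable_matProd_prefixMap n)
    have hev : MeasurableSet {ω : ℕ → CMat k |
        (∀ n : ℕ, ‖wedgeOneEquiv k (matProd id (n + 1) fun i => ω i)‖ ≠ 0) ∧
        Tendsto (fun n : ℕ => 1 / (n : ℝ) *
          Real.log ‖wedgeOneEquiv k (matProd id n fun i => ω i)‖) atTop (𝓝 c)} := by
      refine MeasurableSet.inter ?_ ?_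
      · have : {ω : ℕ → CMat k |
            ∀ n : ℕ, ‖wedgeOneEquiv k (matProd id (n + 1) fun i => ω i)‖ ≠ 0} =
            ⋂ n : ℕ, {ω | ‖wedgeOneEquiv k (matProd id (n + 1) fun i => ω i)‖ = 0}ᶜ := by
          ext ω
          simp
        change MeasurableSet {ω : ℕ → CMat k |
            ∀ n : ℕ, ‖wedgeOneEquiv k (matProd id (n + 1) fun i => ω i)‖ ≠ 0}
        rw [this]
        exact MeasurableSet.iInter fun n =>
          (measurableSet_eq_fun (hmeas (n + 1)) measurable_const).compl
      · exact measurableSet_tendsto _ fun n => (hmeas n).log.const_mul _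
    filter_upwards [ae_mixture_of_ae ν hev fun j =>
      (hm j).ae_tendsto_log_norm hP hirr hπ (single_mem_stdSimplex ℝ j)] with z hz
    have h0 : rankOneSpectrum k c 0 = (c : EReal) := by simp [rankOneSpectrum]
    rw [h0]
    exact tendsto_ereal_log (fun n => norm_nonneg _) hz.1 hz.2
  · have hbot : ∑ j : Fin k with j.val < p, rankOneSpectrum k c j = ⊥ :=
      sum_eq_bot_of_eq_bot (j := ⟨1, by omega⟩) (by simp; omega) (by simp [rankOneSpectrum])
    rw [hbot]
    -- Almost surely every factor is a multiple of a matrix unit, so for `p ≥ 2` the leftmost one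
    -- annihilates `⋀^p W_n` for every `n ≥ 1`.
    have hev : MeasurableSet {ω : ℕ → CMat k |
        ∀ n, ω n ∈ Set.range fun q : Fin k × Fin k => transMat P q.1 q.2} := by
      have : {ω : ℕ → CMat k |
          ∀ n, ω n ∈ Set.range fun q : Fin k × Fin k => transMat P q.1 q.2} =
          ⋂ n : ℕ, (fun ω : ℕ → CMat k => ω n) ⁻¹'
            Set.range fun q : Fin k × Fin k => transMat P q.1 q.2 := by
        ext ω
        simp
      rw [this]
      exact MeasurableSet.iInter fun n =>
        (measurable_pi_apply n) (Set.finite_range _).measurableSet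
    filter_upwards [ae_mixture_of_ae ν hev fun j => Eventually.of_forall fun s n =>
      ⟨(s (n + 1), s n), rfl⟩] with z hz
    refine tendsto_const_nhds.congr' ?_
    filter_upwards [eventually_gt_atTop 0] with n hn
    obtain ⟨n, rfl⟩ := Nat.exists_eq_succ_of_ne_zero hn.ne'
    have hw : wedgeNorm p (matProd id (n + 1) fun i : Fin (n + 1) => z.2 i) = 0 := by
      obtain ⟨q, hq⟩ := hz n
      change wedgeNorm p (z.2 n * matProd id n fun i : Fin n => z.2 i) = 0
      rw [← hq]
      exact wedgeNorm_mul_of_exteriorPower_map_eq_zero _ (exteriorPower_map_single hp _ _ _)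
    rw [Nat.succ_eq_add_one, hw, ENNReal.ofReal_zero, ENNReal.log_zero,
      EReal.coe_mul_bot_of_pos (by positivity)]

lemma IsLyapunovSpectrum.eq_rankOneSpectrum [NeZero k]
    (hP : P ∈ Matrix.colStochastic ℝ (Fin k)) {c : ℝ}
    (hγ : IsLyapunovSpectrum (markovChannelMeasure P) id (rankOneSpectrum k c))
    {γ' : Fin k → EReal} (hγ' : IsLyapunovSpectrum (markovChannelMeasure P) id γ') :
    γ' = rankOneSpectrum k c := by
  choose m hm using fun j : Fin k => exists_isMarkovLaw hP (single_mem_stdSimplex ℝ j)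
  -- Any point would do: a single trajectory law on which both almost sure limits hold already
  -- identifies the partial sums.
  let x : CProj k := Projectivization.mk ℂ (EuclideanSpace.single 0 1) (by simp)
  have hQ := isTrajectoryLaw_mixture hP.1 hm (Measure.dirac x)
  have := hQ.1
  have hsum : ∀ p : ℕ, 1 ≤ p → p ≤ k →
      ∑ j : Fin k with j.val < p, γ' j = ∑ j : Fin k with j.val < p, rankOneSpectrum k c j := by
    intro p hp1 hpk
    obtain ⟨z, hz, hz'⟩ := ((hγ.2.2 _ inferInstance _ hQ p hp1 hpk).and
      (hγ'.2.2 _ inferInstance _ hQ p hp1 hpk)).exists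
    exact tendsto_nhds_unique hz' hz
  have h0 : γ' 0 = (c : EReal) := by
    have := hsum 1 le_rfl (NeZero.one_le)
    rw [sum_filter_val_lt_one, sum_filter_val_lt_one] at this
    rw [this]
    simp [rankOneSpectrum]
  funext j
  rcases Nat.eq_zero_or_pos j.val with hj | hj
  · have : j = 0 := Fin.ext hj
    rw [this, h0]
    simp [rankOneSpectrum]
  · have hk : 1 < k := by omega
    have h2 := hsum 2 (by norm_num) hk
    rw [sum_eq_bot_of_eq_bot (γ := rankOneSpectrum k c) (j := ⟨1, hk⟩) (by simp)
      (by simp [rankOneSpectrum])] at h2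
    have hfilter : (Finset.univ.filter fun j : Fin k => j.val < 2) = {0, ⟨1, hk⟩} := by
      ext a
      simp only [Finset.mem_filter, Finset.mem_univ, true_and, Finset.mem_insert,
        Finset.mem_singleton, Fin.ext_iff, Fin.val_zero]
      omega
    -- As `c` is finite, a sum equal to `⊥` forces the second exponent to be `⊥`; monotonicity then
    -- settles the later ones.
    rw [hfilter, Finset.sum_pair (by simp [Fin.ext_iff]), h0, EReal.add_eq_bot_iff] at h2
    have h1 : γ' ⟨1, hk⟩ = ⊥ := h2.resolve_left (EReal.coe_ne_bot _)
    have hle := hγ'.1 (show (⟨1, hk⟩ : Fin k) ≤ j from hj)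
    rw [h1, le_bot_iff] at hle
    rw [hle, rankOneSpectrum, if_neg hj.ne']

end Lyapunov

theorem mainTheorem2 {k : ℕ} [NeZero k] (P : Matrix (Fin k) (Fin k) ℝ)
    (hP : P ∈ Matrix.colStochastic ℝ (Fin k)) (hirr : P.IsIrreducible) :
    -- the process `ℙ_ν` exists and is unique for every initial law `ν`
    (∀ ν : Measure (CProj k), IsProbabilityMeasure ν →
      ∃! Q, IsTrajectoryLaw (markovChannelMeasure P) id ν Q) ∧
    -- `π` is the unique invariant probability vector, `m` the law of the stationary chain,
    -- `γ` the unique family of Lyapunov exponents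
    ∃ (π : Fin k → ℝ) (m : Measure (ℕ → Fin k)) (γ : Fin k → EReal),
      (∀ π', IsInvariantProbVector P π' ↔ π' = π) ∧
      (∀ m', IsMarkovLaw P π m' ↔ m' = m) ∧
      MeasurePreserving seqShift m m ∧
      (∀ γ', IsLyapunovSpectrum (markovChannelMeasure P) id γ' ↔ γ' = γ) ∧
      γ 0 = ((1 / 2 * ∑ i, ∑ j, π j * P i j * Real.log (P i j) : ℝ) : EReal) ∧
      γ 0 = -kolmogorovEntropy seqShift m / 2 ∧
      ∀ hk : 1 < k, γ ⟨1, hk⟩ = ⊥ := by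
  refine ⟨fun ν _ => ?_, ?_⟩
  · choose m hm using fun j : Fin k => exists_isMarkovLaw hP (single_mem_stdSimplex ℝ j)
    exact ⟨_, isTrajectoryLaw_mixture hP.1 hm ν,
      fun Q hQ => hQ.unique (isTrajectoryLaw_mixture hP.1 hm ν)⟩
  · obtain ⟨π, hπ, hπu⟩ := existsUnique_isInvariantProbVector hP hirr
    obtain ⟨m, hm⟩ := exists_isMarkovLaw hP hπ.1
    have hγ := isLyapunovSpectrum_rankOneSpectrum hP hirr hπ
    refine ⟨π, m, _, fun π' => ⟨hπu π', fun h => h ▸ hπ⟩,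
      fun m' => ⟨fun h => h.unique hm, fun h => h ▸ hm⟩,
      hm.measurePreserving_seqShift hP.1 hπ.1.1 hπ.2,
      fun γ' => ⟨fun h => hγ.eq_rankOneSpectrum hP h, fun h => h ▸ hγ⟩, ?_, ?_, fun hk => ?_⟩
    · simp [rankOneSpectrum]
    · have h2 : (2 : EReal) = ((2 : ℝ) : EReal) := rfl
      rw [hm.kolmogorovEntropy_eq hP hπ, h2, ← EReal.coe_neg, ← EReal.coe_div, rankOneSpectrum,
        if_pos (Fin.val_zero _)]
      congr 1
      rw [entropyRate]
      ring
    · simp [rankOneSpectrum]
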